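/- **Setting.** Let $\mathcal X,\mathcal Y$ be nonempty standard Borel spaces, $\mathcal Z=\mathcal X\times\mathcal Y$, $T\ge 1$, and let $Z_t=(X_t,Y_t)$, $t=1,\dots,T+1$, be a stochastic process with values in $\mathcal Z$ on a probability space, with no stationarity or mixing assumption. Write $\mathbf Z_1^{t}=(Z_1,\dots,Z_t)$ and let $\mathbf p_t(\cdot\mid \mathbf z_1^{t-1})$ be the (regular) conditional distribution of $Z_t$ given $\mathbf Z_1^{t-1}=\mathbf z_1^{t-1}$. Let $\mathcal F=\{f_h: h\in H\}$ be a family of functions $\mathcal Z\to\mathbb R$ with $|f_h|\le M$ for all $h$, let $q(f_h,x,z)\in[-B,B]$ be weights defined for $h\in H$, $x\in\mathcal X$, $z\in\mathcal Z$, where $H$ is a standard Borel space and $(h,z)\mapsto f_h(z)$ and $(h,x,z)\mapsto q(f_h,x,z)$ are measurable (the weights may more generally depend on $h$ itself). Conditional expectations are taken with respect to the $\mathbf p_t$: $$\mathbb E[f(Z_{T+1})\mid\mathbf Z_1^T]=\int f\,d\mathbf p_{T+1}(\cdot\mid\mathbf Z_1^T),\qquad \mathbb E_{Z_t}[g(X_{T+1},Z_t)\mid\mathbf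 Z_1^{t-1}]=\int g(X_{T+1},z)\,\mathbf p_t(dz\mid\mathbf Z_1^{t-1}),$$ so in the second one only $Z_t$ is averaged and $X_{T+1}$ keeps its realized value. Define $$\mathrm{disc}(q)=\sup_{f\in\mathcal F}\Big(\mathbb E[f(Z_{T+1})\mid\mathbf Z_1^T]-\frac1T\sum_{t=1}^T\mathbb E_{Z_t}\big[q(f,X_{T+1},Z_t)f(Z_t)\mid\mathbf Z_1^{t-1}\big]\Big).$$ **Trees and covering numbers.** A complete binary tree of depth $T$ with values in a set $A$ is a sequence $\mathbf z=(z_1,\dots,z_T)$ of maps $z_t:\{\pm1\}^{t-1}\to A$; write $z_t(\sigma)=z_t(\sigma_1,\dots,\sigma_{t-1})$. Let $\mathcal G=\{(x,z)\mapsto q(f,x,z)f(z): f\in\mathcal F\}$. A set $V$ of real-valued trees is a sequential $\alpha$-cover of $\mathcal G$ on a $\mathcal Z$-valued tree $\mathbf z$ if for all $g\in\mathcal G$, all $x\in\mathcal X$ and all $\sigma\in\{\pm1\}^T$ there is $\mathbf v\in V$ with $\frac1T\sum_{t=1}^T|v_t(\sigma)-g(x,z_t(\sigma))|\le\alpha$;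 $\mathcal N_1(\alpha,\mathcal G,\mathbf z)$ is the least cardinality of such a $V$. The distribution $T(\mathbf P)$ is that of the tree $\mathbf z$ of first components of a random tree of pairs $(Z,Z')$ drawn recursively: at the node reached by $(\sigma_1,\dots,\sigma_{t-1})$, given the pairs drawn at its ancestors, $Z_t$ and $Z_t'$ are drawn independently from $\mathbf p_t(\cdot\mid S_1(\sigma_1),\dots,S_{t-1}(\sigma_{t-1}))$, where $S_s(1)=Z_s$ and $S_s(-1)=Z_s'$ are taken along the path; disjoint subtrees are conditionally independent. **Theorem.** Suppose $X_{T+1}$ is $\mathbf Z_1^T$-measurable. Then for any $\delta>0$, with probability at least $1-\delta$, for all $f\in\mathcal F$ and all $\alpha>0$, $$\mathbb E[f(Z_{T+1})\mid\mathbf Z_1^T]\le\frac1T\sum_{t=1}^Tq(f,X_{T+1},Z_t)f(Z_t)+\mathrm{disc}(q)+2\alpha+2MB\sqrt{\frac{2\log\big(\mathbb E_{\mathbf v\sim T(\mathbf P)}[\mathcal N_1(\alpha,\mathcal G,\mathbf v)]/\delta\big)}{T}},$$ where the square root is read as $0$ when the logarithm is negative (which requires $\delta>1$). The probability statement means that the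 set where the bound fails for some $f$ or $\alpha$ has outer probability at most $\delta$. -/

import Mathlib

open MeasureTheory ProbabilityTheory
open scoped ENNReal

noncomputable section

/-- A complete binary tree of depth `n` with labels in `α`: the label of the root, the subtree
followed after the sign `+1`, and the subtree followed after the sign `-1`. -/
def BTree.{u} (α : Type u) : ℕ → Type u
  | 0 => PUnit.{u + 1}
  | n + 1 => α × (BTree α n × BTree α n)

/-- The product σ-algebra on trees. -/
instance BTree.instMeasurableSpace {α : Type*} [MeasurableSpace α] :
    (n : ℕ) → MeasurableSpace (BTree α n)
  | 0 => ⊤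
  | n + 1 =>
    letI := BTree.instMeasurableSpace (α := α) n
    (inferInstance : MeasurableSpace (α × (BTree α n × BTree α n)))

/-- The label `z_t(σ)` met at time `t` along the path `σ` (`true` is `+1`, `false` is `-1`).
It depends only on the signs of `σ` before time `t`. -/
def BTree.label {α : Type*} : {n : ℕ} → BTree α n → (Fin n → Bool) → Fin n → α
  | 0, _, _ => fun t => t.elim0
  | n + 1, z, σ =>
    Fin.cons (α := fun _ => α) z.1
      (BTree.label (n := n) (if σ 0 then z.2.1 else z.2.2) (Fin.tail σ))

/-- Apply a function to all the labels of a tree. -/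
def BTree.map {α β : Type*} (g : α → β) : {n : ℕ} → BTree α n → BTree β n
  | 0, _ => PUnit.unit
  | n + 1, z => (g z.1, (BTree.map g (n := n) z.2.1, BTree.map g (n := n) z.2.2))

/-- `V` is a sequential `a`-cover, with respect to the `w`-weighted `ℓ₁` norm, of the class `𝒢`
on the tree `z`. The norm `‖w‖` of `Fin n → ℝ` is the maximum norm, the dual of `ℓ₁`. -/
def IsSeqCover {α : Type*} {n : ℕ} (w : Fin n → ℝ) (a : ℝ) (𝒢 : Set (α → ℝ)) (z : BTree α n)
    (V : Set (BTree ℝ n)) : Prop :=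
  ∀ g ∈ 𝒢, ∀ σ : Fin n → Bool, ∃ v ∈ V,
    ∑ t, |v.label σ t - g (z.label σ t)| ≤ ‖w‖⁻¹ * a

/-- The sequential covering number `𝒩₁(a, 𝒢, z)`: the least cardinality of a sequential cover. -/
def seqCoveringNumber {α : Type*} {n : ℕ} (w : Fin n → ℝ) (a : ℝ) (𝒢 : Set (α → ℝ))
    (z : BTree α n) : ℕ∞ :=
  ⨅ V ∈ {V : Set (BTree ℝ n) | IsSeqCover w a 𝒢 z V}, V.encard

theorem measurable_snoc {α : Type*} [MeasurableSpace α] (t : ℕ) :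
    Measurable fun x : (Fin t → α) × α => (Fin.snoc x.1 x.2 : Fin (t + 1) → α) := by
  refine measurable_pi_iff.2 fun i => ?_
  refine Fin.lastCases ?_ (fun j => ?_) i
  · simpa using measurable_snd
  · simpa using! (measurable_pi_apply j).comp (measurable_fst (β := α))

/-- Given a history `w` of length `t`: draw a pair `(Z, Z')` with `Z` and `Z'` independent of law
`κ w`, then draw independently a first object of law `η (w, Z)` and a second one of law
`η (w, Z')`. -/
def branchKernel {α β : Type*} [MeasurableSpace α] [MeasurableSpace β] {t : ℕ}
    (κ : Kernel (Fin t → α) α) (η : Kernel (Fin (t + 1) → α) β) :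
    Kernel (Fin t → α) ((α × α) × (β × β)) :=
  (κ ×ₖ κ) ⊗ₖ
    (η.comap (fun x : (Fin t → α) × (α × α) => (Fin.snoc x.1 x.2.1 : Fin (t + 1) → α))
        ((measurable_snoc t).comp
          (measurable_fst.prodMk (measurable_fst.comp measurable_snd))) ×ₖ
      η.comap (fun x : (Fin t → α) × (α × α) => (Fin.snoc x.1 x.2.2 : Fin (t + 1) → α))
        ((measurable_snoc t).comp
          (measurable_fst.prodMk (measurable_snd.comp measurable_snd))))

instance branchKernel.instIsMarkovKernel {α β : Type*} [MeasurableSpace α] [MeasurableSpace β]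
    {t : ℕ} (κ : Kernel (Fin t → α) α) [IsMarkovKernel κ] (η : Kernel (Fin (t + 1) → α) β)
    [IsMarkovKernel η] : IsMarkovKernel (branchKernel κ η) := by
  unfold branchKernel
  infer_instance

/-- The law of a random tree of pairs `(Z, Z')` with `n` levels, given a history of length `t`, for
conditional distributions `p`: the pair at the root has independent components of law `p t`, and
the subtree after `+1` (after `-1`) is drawn with `Z` (with `Z'`) appended to the history. -/
def treeKernel {α : Type*} [MeasurableSpace α] (p : (t : ℕ) → Kernel (Fin t → α) α) :
    (n t : ℕ) → Kernel (Fin t → α) (BTree (α × α) n)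
  | 0, _ => Kernel.const _ (Measure.dirac PUnit.unit)
  | n + 1, t => branchKernel (p t) (treeKernel p n (t + 1))

instance treeKernel.instIsMarkovKernel {α : Type*} [MeasurableSpace α]
    (p : (t : ℕ) → Kernel (Fin t → α) α) [∀ t, IsMarkovKernel (p t)] :
    (n t : ℕ) → IsMarkovKernel (treeKernel p n t)
  | 0, _ => ⟨fun _ => Measure.dirac.isProbabilityMeasure⟩
  | n + 1, t =>
    have := treeKernel.instIsMarkovKernel p n (t + 1)
    branchKernel.instIsMarkovKernel (p t) (treeKernel p n (t + 1))

/-- The expected covering number `E_{z ∼ T(p)} 𝒩₁(a, 𝒢, z)`, where `z` is the tree of the first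
components `Z` of a random tree of pairs `(Z, Z')` drawn from the empty history. -/
def expectedCoveringNumber {α : Type*} [MeasurableSpace α]
    (p : (t : ℕ) → Kernel (Fin t → α) α) {n : ℕ} (w : Fin n → ℝ) (a : ℝ) (𝒢 : Set (α → ℝ)) :
    ℝ≥0∞ :=
  ∫⁻ τ, (seqCoveringNumber w a 𝒢 (τ.map Prod.fst) : ℝ≥0∞) ∂(treeKernel p n 0 Fin.elim0)

/-- The observations before time `t`, that is `Z_1, …, Z_t` (indexed from `0`). -/
def history {Ω α : Type*} (Z : ℕ → Ω → α) (t : ℕ) (ω : Ω) : Fin t → α := fun i => Z i ω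

/-- The conditional distribution of the observation of index `t` given those before it. -/
def condLaw {Ω α : Type*} [MeasurableSpace Ω] [MeasurableSpace α] [StandardBorelSpace α]
    [Nonempty α] (P : Measure Ω) [IsFiniteMeasure P] (Z : ℕ → Ω → α) (t : ℕ) :
    Kernel (Fin t → α) α :=
  condDistrib (Z t) (history Z t) P

instance condLaw.instIsMarkovKernel {Ω α : Type*} [MeasurableSpace Ω] [MeasurableSpace α]
    [StandardBorelSpace α] [Nonempty α] (P : Measure Ω) [IsFiniteMeasure P] (Z : ℕ → Ω → α)
    (t : ℕ) : IsMarkovKernel (condLaw P Z t) := by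
  unfold condLaw
  infer_instance

section Forecasting

variable {Ω 𝒳 𝒴 H : Type*} [MeasurableSpace Ω]
  [MeasurableSpace 𝒳] [StandardBorelSpace 𝒳] [Nonempty 𝒳]
  [MeasurableSpace 𝒴] [StandardBorelSpace 𝒴] [Nonempty 𝒴]

/-- `E[f(Z_{T+1}) | Z_1, …, Z_T]` at `ω`. -/
def targetRisk (P : Measure Ω) [IsFiniteMeasure P] (Z : ℕ → Ω → 𝒳 × 𝒴) (T : ℕ)
    (f : 𝒳 × 𝒴 → ℝ) (ω : Ω) : ℝ :=
  ∫ z, f z ∂(condLaw P Z T (history Z T ω))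

/-- `E_{Z_t}[g(X_{T+1}, Z_t) | Z_1, …, Z_{t-1}]` at `ω` (with times indexed from `0`): the
expectation is over `Z_t` only, and `X_{T+1}` keeps its realized value. -/
def frozenRisk (P : Measure Ω) [IsFiniteMeasure P] (Z : ℕ → Ω → 𝒳 × 𝒴) (T t : ℕ)
    (g : 𝒳 → 𝒳 × 𝒴 → ℝ) (ω : Ω) : ℝ :=
  ∫ z, g (Z T ω).1 z ∂(condLaw P Z t (history Z t ω))

/-- The discrepancy of the data-dependent weights `q` for the family `(f_h)`. -/
def weightedDisc (P : Measure Ω) [IsFiniteMeasure P] (Z : ℕ → Ω → 𝒳 × 𝒴) (T : ℕ)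
    (f : H → 𝒳 × 𝒴 → ℝ) (q : H → 𝒳 → 𝒳 × 𝒴 → ℝ) (ω : Ω) : ℝ :=
  ⨆ h, (targetRisk P Z T (f h) ω -
    (1 / T : ℝ) * ∑ t ∈ Finset.range T, frozenRisk P Z T t (fun x z => q h x z * f h z) ω)

/-- The functions `z ↦ q(f_h, x, z) f_h(z)`: the class of products `q · f`, as functions of the
observation `z`, with the query point `x` as a further parameter. -/
def productClass (f : H → 𝒳 × 𝒴 → ℝ) (q : H → 𝒳 → 𝒳 × 𝒴 → ℝ) : Set (𝒳 × 𝒴 → ℝ) :=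
  {g | ∃ (h : H) (x : 𝒳), g = fun z => q h x z * f h z}

end Forecasting

end

open MeasureTheory ProbabilityTheory
open scoped ENNReal

noncomputable section

/-! By definition the discrepancy dominates the target risk minus the average frozen risk of every
`h`. Where the bound fails for some `h` and `α`, the sum of conditional expectations of `z ↦ q h x z
* f h z` therefore exceeds the sum of its observed values by more than the threshold times `T`, with
`x` the realized query point. Treating `x` as a free parameter besides `h`, it suffices to bound
these deviations uniformly over pairs `(h, x)`.

The existence of a bad pair defines the projection of a measurable set, which is only analytic.
Measurable selection (`exists_measurable_section`) replaces the supremum by a measurable choice `s`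
of the pair as a function of the whole path, losing arbitrarily little probability. It remains to
bound an exponential moment of the deviation at `s` (`lintegral_exp_deviation_le`).

The path has the law of the first components along the all-plus branch of the random tree
(`lintegral_history_eq`). Jensen replaces the conditional expectations by the second components, a
tangent sequence (`lintegral_exp_condSum_le`). Exchanging pairs after minus signs preserves the law
(`lintegral_signSwap_label`), so random signs can be inserted; the inequality `2xy ≤ x² + y²` then
separates first from second components at the price of doubling the exponent. On a fixed tree the
selected function still depends on the signs. Summing over a sequential cover removes that
dependence, and each covering tree obeys a Hoeffding bound (`sum_exp_label_le`).

Chernoff's inequality at the optimal parameter gives the threshold; both factors `2` in it come from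
the doubled exponent. All scales `α` hold together at no cost, because their failure events are
ordered by deterministic thresholds. -/

/-! ### Measurable selection through the Baire space. -/

theorem continuous_cantorFunction {c : ℝ} (h0 : 0 ≤ c) (h1 : c < 1) :
    Continuous (Cardinal.cantorFunction c) := by
  refine continuous_tsum (u := fun n => c ^ n) (fun n => ?_)
    (summable_geometric_of_lt_one h0 h1) fun n x => ?_
  · exact (continuous_of_discreteTopology (f := fun b : Bool => cond b (c ^ n) 0)).comp
      (continuous_apply n)
  · cases h : x n <;> simp [h, abs_of_nonneg h0, pow_nonneg h0]

/-- The Baire space embeds continuously into the real line. -/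
theorem exists_continuous_injective_baire :
    ∃ e : (ℕ → ℕ) → ℝ, Continuous e ∧ Function.Injective e := by
  -- A sequence is coded by the indicator of its graph. Each binary digit reads one coordinate,
  -- whence continuity; a ratio below `1 / 2` makes `cantorFunction` injective.
  refine ⟨fun x => Cardinal.cantorFunction (1 / 3)
    fun n => decide (x n.unpair.1 = n.unpair.2), ?_, fun x y h => ?_⟩
  · refine (continuous_cantorFunction (by norm_num) (by norm_num)).comp
      (continuous_pi fun n => ?_)
    exact (continuous_of_discreteTopology (f := fun k : ℕ => decide (k = n.unpair.2))).comp
      (continuous_apply n.unpair.1)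
  · have h' := Cardinal.cantorFunction_injective (by norm_num) (by norm_num) h
    funext i
    have := congrFun h' (Nat.pair i (x i))
    simpa [eq_comm] using this

theorem isCompact_setOf_le_baire (b : ℕ → ℕ) : IsCompact {x : ℕ → ℕ | ∀ i, x i ≤ b i} := by
  have := isCompact_univ_pi (X := fun _ : ℕ => ℕ) (s := fun i => Set.Iic (b i))
    fun i => (Set.finite_Iic (b i)).isCompact
  convert this using 1
  ext x
  simp [Pi.le_def]

/-- An open set containing a compact box of the Baire space contains the box where only finitely
many coordinates are bounded. -/
theorem exists_forall_lt_le_subset_of_isOpen {b : ℕ → ℕ} {U : Set (ℕ → ℕ)} (hU : IsOpen U)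
    (h : {x : ℕ → ℕ | ∀ i, x i ≤ b i} ⊆ U) : ∃ k, {x : ℕ → ℕ | ∀ i < k, x i ≤ b i} ⊆ U := by
  by_contra! hcon
  simp only [Set.not_subset] at hcon
  choose x hx hxU using hcon
  -- The counterexamples need not lie in the compact box. Truncating them does put them there, and
  -- each coordinate is eventually unchanged, so the limit is the same.
  obtain ⟨y, hy, φ, hφ, hlim⟩ := (isCompact_setOf_le_baire b).tendsto_subseq
    (x := fun k i => min (x k i) (b i)) fun k i => min_le_right _ _
  have hlim' : Filter.Tendsto (fun n => x (φ n)) Filter.atTop (nhds y) := by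
    rw [tendsto_pi_nhds] at hlim ⊢
    intro i
    refine (hlim i).congr' ?_
    filter_upwards [Filter.eventually_gt_atTop i] with n hn
    exact min_eq_left (hx (φ n) i (hn.trans_le (hφ.id_le n)))
  obtain ⟨n, hn⟩ := (hlim'.eventually (hU.mem_nhds (h hy))).exists
  exact hxU _ hn

/-- Continuity from below holds for arbitrary increasing sets, so the images, which need not be
measurable, cause no trouble. -/
theorem exists_lt_measure_image_inter_le {Y : Type*} [MeasurableSpace Y] (μ : Measure Y)
    (f : (ℕ → ℕ) → Y) (S : Set (ℕ → ℕ)) {c : ℝ≥0∞} (hc : c < μ (f '' S)) (i : ℕ) :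
    ∃ m : ℕ, c < μ (f '' (S ∩ {x | x i ≤ m})) := by
  have hU : f '' S = ⋃ m : ℕ, f '' (S ∩ {x | x i ≤ m}) := by
    rw [← Set.image_iUnion, ← Set.inter_iUnion]
    congr 1
    refine (Set.inter_eq_left.2 fun x _ => Set.mem_iUnion.2 ⟨x i, le_refl (x i)⟩).symm
  have hmono : Monotone fun m : ℕ => f '' (S ∩ {x | x i ≤ m}) := fun m m' h =>
    Set.image_mono (Set.inter_subset_inter_right _ fun x (hx : x i ≤ m) => hx.trans h)
  rw [hU, hmono.measure_iUnion] at hc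
  exact lt_iSup_iff.1 hc

/-- Inner approximation of the range of a continuous map on the Baire space by images of compact
boxes. -/
theorem exists_le_measure_image_setOf_le {Y : Type*} [TopologicalSpace Y] [T2Space Y]
    [RegularSpace Y] [MeasurableSpace Y] [OpensMeasurableSpace Y] (μ : Measure Y)
    [IsFiniteMeasure μ] {f : (ℕ → ℕ) → Y} (hf : Continuous f) {c : ℝ≥0∞}
    (hc : c < μ (Set.range f)) : ∃ b : ℕ → ℕ, c ≤ μ (f '' {x | ∀ i, x i ≤ b i}) := by
  choose m hm using fun (S : {S : Set (ℕ → ℕ) // c < μ (f '' S)}) =>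
    exists_lt_measure_image_inter_le μ f S.1 S.2
  -- Coordinates are bounded one at a time, each bound keeping the measure of the image above `c`.
  let R : ℕ → {S : Set (ℕ → ℕ) // c < μ (f '' S)} := fun k =>
    Nat.rec ⟨Set.univ, by rwa [Set.image_univ]⟩ (fun i S => ⟨S.1 ∩ {x | x i ≤ m S i}, hm S i⟩) k
  let b : ℕ → ℕ := fun i => m (R i) i
  have hR : ∀ k, (R k).1 = {x | ∀ i < k, x i ≤ b i} := by
    intro k
    induction k with
    | zero => simp [R]
    | succ k ih =>
      have : (R (k + 1)).1 = (R k).1 ∩ {x | x k ≤ b k} := rfl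
      rw [this, ih]
      ext x
      exact Nat.forall_lt_succ_right.symm
  refine ⟨b, ?_⟩
  have hanti : Antitone fun k => closure (f '' (R k).1) := fun k l hkl => by
    simp only [hR]
    exact closure_mono (Set.image_mono fun x hx i hi => hx i (hi.trans_le hkl))
  -- A point off the compact image has a closed neighbourhood `F` missing it. The preimage of `Fᶜ`
  -- contains the box, hence already some `R k`, so the point is not in the closure of the image of
  -- `R k`.
  have hsub : ⋂ k, closure (f '' (R k).1) ⊆ f '' {x | ∀ i, x i ≤ b i} := by
    intro y hy
    by_contra hyK
    have hKc : IsClosed (f '' {x | ∀ i, x i ≤ b i}) :=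
      ((isCompact_setOf_le_baire b).image hf).isClosed
    obtain ⟨F, hFy, hFc, hF⟩ := exists_mem_nhds_isClosed_subset (hKc.isOpen_compl.mem_nhds hyK)
    obtain ⟨k, hk⟩ := exists_forall_lt_le_subset_of_isOpen (b := b)
      (hFc.isOpen_compl.preimage hf) fun x hx hxF => hF hxF ⟨x, hx, rfl⟩
    have hy' := Set.mem_iInter.1 hy k
    rw [hR] at hy'
    obtain ⟨z, hzF, x, hx, rfl⟩ := mem_closure_iff_nhds.1 hy' F hFy
    exact hk hx hzF
  refine le_trans ?_ (measure_mono hsub)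
  rw [hanti.measure_iInter (fun k => isClosed_closure.measurableSet.nullMeasurableSet)
    ⟨0, measure_ne_top _ _⟩]
  exact le_iInf fun k => (R k).2.le.trans (measure_mono subset_closure)

/-- A continuous map on a compact subset of the Baire space has a measurable right inverse. -/
theorem exists_measurable_rightInverse_of_isCompact {Y : Type*} [TopologicalSpace Y] [T2Space Y]
    [MeasurableSpace Y] [OpensMeasurableSpace Y] {f : (ℕ → ℕ) → Y} (hf : Continuous f)
    {K : Set (ℕ → ℕ)} (hK : IsCompact K) :
    ∃ s : Y → ℕ → ℕ, Measurable s ∧ ∀ y ∈ f '' K, s y ∈ K ∧ f (s y) = y := by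
  obtain ⟨e, he, hinj⟩ := exists_continuous_injective_baire
  obtain ⟨e', he', hee'⟩ := (he.measurableEmbedding hinj).exists_measurable_extend
    (measurable_id (α := ℕ → ℕ)) fun _ => inferInstance
  -- In each fibre over `K` the point with the least real code is selected; compactness makes the
  -- infimum attained.
  let r : Y → ℝ := fun y => sInf (e '' (K ∩ f ⁻¹' {y}))
  have hcomp : ∀ y, IsCompact (e '' (K ∩ f ⁻¹' {y})) := fun y =>
    (hK.inter_right (isClosed_singleton.preimage hf)).image he
  have hmem : ∀ y ∈ f '' K, r y ∈ e '' (K ∩ f ⁻¹' {y}) := by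
    rintro y ⟨x, hx, rfl⟩
    exact (hcomp _).sInf_mem ⟨e x, x, ⟨hx, rfl⟩, rfl⟩
  have hr : Measurable r := by
    refine measurable_of_Iic fun a => ?_
    -- Sublevel sets are compact images, up to the points with empty fibre, where `sInf ∅ = 0`.
    have : r ⁻¹' Set.Iic a = f '' (K ∩ e ⁻¹' Set.Iic a) ∪ ((f '' K)ᶜ ∩ {_y | 0 ≤ a}) := by
      ext y
      by_cases hy : y ∈ f '' K
      · have : y ∈ f '' (K ∩ e ⁻¹' Set.Iic a) ↔ r y ≤ a := by
          constructor
          · rintro ⟨x, ⟨hx, hxa⟩, rfl⟩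
            exact (csInf_le (hcomp _).bddBelow ⟨x, ⟨hx, rfl⟩, rfl⟩).trans hxa
          · intro h
            obtain ⟨x, ⟨hx, hxy⟩, hxr⟩ := hmem y hy
            exact ⟨x, ⟨hx, by simpa [hxr] using h⟩, hxy⟩
        simp only [Set.mem_union, this, Set.mem_inter_iff, Set.mem_compl_iff, hy]
        simp
      · have h1 : y ∉ f '' (K ∩ e ⁻¹' Set.Iic a) := fun h =>
          hy (Set.image_mono Set.inter_subset_left h)
        have h2 : K ∩ f ⁻¹' {y} = ∅ := by
          ext x
          simp only [Set.mem_inter_iff, Set.mem_preimage, Set.mem_singleton_iff,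
            Set.mem_empty_iff_false, iff_false]
          exact fun h => hy ⟨x, h⟩
        simp only [Set.mem_union, h1, Set.mem_inter_iff, Set.mem_compl_iff, hy]
        simp [r, h2]
    rw [this]
    refine ((hK.inter_right (isClosed_Iic.preimage he)).image hf).isClosed.measurableSet.union
      ((hK.image hf).isClosed.measurableSet.compl.inter (MeasurableSet.const _))
  refine ⟨e' ∘ r, he'.comp hr, fun y hy => ?_⟩
  obtain ⟨x, ⟨hx, hxy⟩, hxr⟩ := hmem y hy
  have : e' (r y) = x := by
    rw [← hxr]
    exact congrFun hee' x
  simp only [Function.comp_apply, this]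
  exact ⟨hx, hxy⟩

/-- Measurable selection: a measurable subset of a product has a measurable section defined on a
set whose measure is arbitrarily close to the outer measure of the projection. -/
theorem exists_measurable_section {Y W : Type*} [MeasurableSpace Y] [StandardBorelSpace Y]
    [MeasurableSpace W] [StandardBorelSpace W] [Nonempty W] (μ : Measure Y) [IsFiniteMeasure μ]
    {D : Set (Y × W)} (hD : MeasurableSet D) {c : ℝ≥0∞} (hc : c < μ (Prod.fst '' D)) :
    ∃ A : Set Y, MeasurableSet A ∧ c ≤ μ A ∧
      ∃ s : Y → W, Measurable s ∧ ∀ y ∈ A, (y, s y) ∈ D := by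
  let := upgradeStandardBorel Y
  let := upgradeStandardBorel W
  have hA := hD.analyticSet
  rw [AnalyticSet] at hA
  rcases hA with rfl | ⟨f, hf, rfl⟩
  · simp at hc
  rw [← Set.range_comp] at hc
  have hf1 : Continuous (Prod.fst ∘ f) := continuous_fst.comp hf
  obtain ⟨b, hb⟩ := exists_le_measure_image_setOf_le μ hf1 hc
  have hK := isCompact_setOf_le_baire b
  obtain ⟨s, hs, hsK⟩ := exists_measurable_rightInverse_of_isCompact hf1 hK
  refine ⟨_, (hK.image hf1).isClosed.measurableSet, hb, fun y => (f (s y)).2,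
    (measurable_snd.comp hf.measurable).comp hs, fun y hy => ⟨s y, ?_⟩⟩
  exact Prod.ext (hsK y hy).2 rfl

/-! ### Random trees of pairs: sign symmetry and the tangent sequence. -/

section TreeKernel

variable {α : Type*} [MeasurableSpace α]

/-- The tree with root label `z` and subtrees `l` (after `+1`) and `r` (after `-1`). -/
def BTree.node {β : Type*} {n : ℕ} (z : β) (l r : BTree β n) : BTree β (n + 1) := (z, (l, r))

theorem BTree.label_node {β : Type*} {n : ℕ} (z : β) (l r : BTree β n)
    (σ : Fin (n + 1) → Bool) :
    (BTree.node z l r).label σ = Fin.cons (α := fun _ => β) z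
      (BTree.label (if σ 0 then l else r) (Fin.tail σ)) := rfl

theorem measurable_fin_cons (n : ℕ) :
    Measurable fun x : α × (Fin n → α) => (Fin.cons x.1 x.2 : Fin (n + 1) → α) := by
  refine measurable_pi_iff.2 fun i => ?_
  refine Fin.cases ?_ (fun j => ?_) i
  · simpa using measurable_fst
  · simpa using! (measurable_pi_apply j).comp (measurable_snd (α := α))

theorem BTree.measurable_label {n : ℕ} (σ : Fin n → Bool) :
    Measurable fun z : BTree α n => z.label σ := by
  induction n with
  | zero => exact measurable_pi_iff.2 fun i => i.elim0
  | succ n ih =>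
    have h2 : Measurable fun z : α × (BTree α n × BTree α n) =>
        BTree.label (if σ 0 then z.2.1 else z.2.2) (Fin.tail σ) := by
      by_cases h : σ 0
      · simpa [h] using! (ih (Fin.tail σ)).comp (measurable_fst.comp measurable_snd)
      · simpa [h] using! (ih (Fin.tail σ)).comp (measurable_snd.comp measurable_snd)
    exact (measurable_fin_cons n).comp (measurable_fst.prodMk h2)

theorem measurable_lintegral_comp {γ δ β : Type*} [MeasurableSpace γ] [MeasurableSpace δ]
    [MeasurableSpace β] (η : Kernel δ β) [IsSFiniteKernel η] {g : γ → δ} (hg : Measurable g)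
    {Q : γ × β → ℝ≥0∞} (hQ : Measurable Q) :
    Measurable fun c => ∫⁻ b, Q (c, b) ∂(η (g c)) :=
  Measurable.lintegral_kernel_prod_right' (κ := η.comap g hg) hQ

theorem lintegral_branchKernel {β : Type*} [MeasurableSpace β] {t : ℕ}
    (κ : Kernel (Fin t → α) α) [IsMarkovKernel κ] (η : Kernel (Fin (t + 1) → α) β)
    [IsMarkovKernel η] (x : Fin t → α) {Q : (α × α) × (β × β) → ℝ≥0∞} (hQ : Measurable Q) :
    ∫⁻ y, Q y ∂(branchKernel κ η x) =
      ∫⁻ u, ∫⁻ v, ∫⁻ l, ∫⁻ r, Q ((u, v), (l, r)) ∂(η (Fin.snoc x v)) ∂(η (Fin.snoc x u))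
        ∂(κ x) ∂(κ x) := by
  have hs : Measurable fun z : α => (Fin.snoc x z : Fin (t + 1) → α) :=
    (measurable_snoc t).comp measurable_prodMk_left
  rw [branchKernel, Kernel.lintegral_compProd _ _ _ hQ, Kernel.lintegral_prod]
  · refine lintegral_congr fun u => lintegral_congr fun v => ?_
    rw [Kernel.lintegral_prod]
    · rfl
    · exact hQ.comp measurable_prodMk_left
  · exact (hQ.lintegral_kernel_prod_right''
      (η := (η.comap (fun x : (Fin t → α) × (α × α) => (Fin.snoc x.1 x.2.1 : Fin (t + 1) → α))
        ((measurable_snoc t).comp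
          (measurable_fst.prodMk (measurable_fst.comp measurable_snd))) ×ₖ
      η.comap (fun x : (Fin t → α) × (α × α) => (Fin.snoc x.1 x.2.2 : Fin (t + 1) → α))
        ((measurable_snoc t).comp
          (measurable_fst.prodMk (measurable_snd.comp measurable_snd))))) (a := x))

theorem lintegral_treeKernel_succ (p : (t : ℕ) → Kernel (Fin t → α) α) [∀ t, IsMarkovKernel (p t)]
    (n t : ℕ) (x : Fin t → α)
    {Q : BTree (α × α) (n + 1) → ℝ≥0∞} (hQ : Measurable Q) :
    ∫⁻ τ, Q τ ∂(treeKernel p (n + 1) t x) =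
      ∫⁻ u, ∫⁻ v, ∫⁻ l, ∫⁻ r, Q (BTree.node (u, v) l r) ∂(treeKernel p n (t + 1) (Fin.snoc x v))
        ∂(treeKernel p n (t + 1) (Fin.snoc x u)) ∂(p t x) ∂(p t x) :=
  lintegral_branchKernel (p t) (treeKernel p n (t + 1)) x hQ

/-- Exchange the two components of the pairs met after the sign `-1`. -/
def signSwap {α : Type*} {n : ℕ} (σ : Fin n → Bool) (w : Fin n → α × α) : Fin n → α × α :=
  fun i => if σ i then w i else (w i).swap

theorem measurable_signSwap {n : ℕ} (σ : Fin n → Bool) :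
    Measurable (signSwap (α := α) σ) := by
  refine measurable_pi_iff.2 fun i => ?_
  by_cases h : σ i
  · simpa [signSwap, h] using measurable_pi_apply i
  · simpa [signSwap, h] using! measurable_swap.comp (measurable_pi_apply (X := fun _ => α × α) i)

theorem signSwap_signSwap {α : Type*} {n : ℕ} (σ : Fin n → Bool) (w : Fin n → α × α) :
    signSwap σ (signSwap σ w) = w := by
  funext i
  by_cases h : σ i <;> simp [signSwap, h]

theorem signSwap_cons {α : Type*} {n : ℕ} (σ : Fin (n + 1) → Bool) (z : α × α) (w : Fin n → α × α) :
    signSwap σ (Fin.cons z w : Fin (n + 1) → α × α) =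
      Fin.cons (α := fun _ => α × α) (if σ 0 then z else z.swap) (signSwap (Fin.tail σ) w) := by
  funext i
  refine Fin.cases ?_ (fun j => ?_) i
  · simp [signSwap]
  · simp only [signSwap, Fin.cons_succ]
    rfl

/-- Along every path of signs, the pairs of a random tree, exchanged after each sign `-1`, have the
law of the pairs along the path of signs `+1`. -/
theorem lintegral_signSwap_label (p : (t : ℕ) → Kernel (Fin t → α) α)
    [∀ t, IsMarkovKernel (p t)] {n : ℕ} (t : ℕ) (x : Fin t → α) (σ : Fin n → Bool)
    {F : (Fin n → α × α) → ℝ≥0∞} (hF : Measurable F) :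
    ∫⁻ τ, F (signSwap σ (τ.label σ)) ∂(treeKernel p n t x) =
      ∫⁻ τ, F (τ.label fun _ => true) ∂(treeKernel p n t x) := by
  induction n generalizing t with
  | zero =>
    refine lintegral_congr fun τ => ?_
    congr 1
    exact Subsingleton.elim _ _
  | succ n ih =>
    have hcons : ∀ z : α × α, Measurable fun w : Fin n → α × α =>
        F (Fin.cons (α := fun _ => α × α) z w) :=
      fun z => hF.comp ((measurable_fin_cons n).comp measurable_prodMk_left)
    rw [lintegral_treeKernel_succ p n t x (Q := fun τ => F (signSwap σ (τ.label σ)))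
        (hF.comp ((measurable_signSwap σ).comp (BTree.measurable_label σ))),
      lintegral_treeKernel_succ p n t x
        (Q := fun τ => F (τ.label fun _ => true))
        (hF.comp (BTree.measurable_label _))]
    simp only [BTree.label_node, signSwap_cons, if_true]
    have htail : (Fin.tail fun _ : Fin (n + 1) => true) = fun _ => true := rfl
    simp only [htail, lintegral_const, measure_univ, mul_one]
    by_cases h : σ 0
    · simp only [h, if_true, lintegral_const, measure_univ, mul_one]
      exact lintegral_congr fun u => lintegral_congr fun v =>
        ih (t + 1) (Fin.snoc x u) (Fin.tail σ) (hcons (u, v))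
    · simp only [h, lintegral_const, measure_univ, mul_one, Prod.swap_prod_mk, Bool.false_eq_true,
        if_false]
      have hs : Measurable fun z : α × α => (Fin.snoc x z.2 : Fin (t + 1) → α) :=
        (measurable_snoc t).comp (measurable_const.prodMk measurable_snd)
      -- After `-1` the path continues from the second component, and the root pair is exchanged. As
      -- the two components are i.i.d., Tonelli lets them trade roles.
      rw [lintegral_lintegral_swap]
      · exact lintegral_congr fun u => lintegral_congr fun v =>
          ih (t + 1) (Fin.snoc x u) (Fin.tail σ) (hcons (u, v))
      · refine (measurable_lintegral_comp (treeKernel p n (t + 1)) hs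
          (Q := fun z => F (Fin.cons (α := fun _ => α × α) (z.1.2, z.1.1)
            (signSwap (Fin.tail σ) (z.2.label (Fin.tail σ))))) ?_).aemeasurable
        refine hF.comp ((measurable_fin_cons n).comp (Measurable.prodMk ?_ ?_))
        · exact measurable_swap.comp measurable_fst
        · exact (measurable_signSwap _).comp ((BTree.measurable_label _).comp measurable_snd)

theorem signSwap_not {α : Type*} {n : ℕ} (σ : Fin n → Bool) (w : Fin n → α × α) :
    signSwap (fun i => !σ i) w = signSwap σ fun i => (w i).swap := by
  funext i
  by_cases h : σ i <;> simp [signSwap, h]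

/-- Both `σ` and its opposite reduce to the all-plus branch. Their exchanges differ by swapping
every pair, and `signSwap σ` is an involution. -/
theorem lintegral_label_eq_lintegral_swap (p : (t : ℕ) → Kernel (Fin t → α) α)
    [∀ t, IsMarkovKernel (p t)] {n : ℕ} (t : ℕ) (x : Fin t → α) (σ : Fin n → Bool)
    {F : (Fin n → α × α) → ℝ≥0∞} (hF : Measurable F) :
    ∫⁻ τ, F (τ.label σ) ∂(treeKernel p n t x) =
      ∫⁻ τ, F (fun i => (τ.label (fun j => !σ j) i).swap) ∂(treeKernel p n t x) := by
  have hF' := hF.comp (measurable_signSwap (α := α) σ)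
  have h := (lintegral_signSwap_label p t x σ hF').trans
    (lintegral_signSwap_label p t x (fun j => !σ j) hF').symm
  simpa only [Function.comp_apply, signSwap_not, signSwap_signSwap] using h

/-- The sum of the integrals of `φ` with respect to the conditional distributions met when the
observations `u` follow the history `x`. -/
def condSum (p : (t : ℕ) → Kernel (Fin t → α) α) (φ : α → ℝ) :
    (n t : ℕ) → (Fin t → α) → (Fin n → α) → ℝ
  | 0, _, _, _ => 0
  | n + 1, t, x, u =>
    ∫ v, φ v ∂(p t x) + condSum p φ n (t + 1) (Fin.snoc x (u 0)) (Fin.tail u)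

theorem measurable_condSum (p : (t : ℕ) → Kernel (Fin t → α) α) [∀ t, IsMarkovKernel (p t)]
    {γ : Type*} [MeasurableSpace γ] {g : γ × α → ℝ} (hg : Measurable g) {n t : ℕ}
    {x : γ → Fin t → α} (hx : Measurable x) {u : γ → Fin n → α} (hu : Measurable u) :
    Measurable fun c => condSum p (fun v => g (c, v)) n t (x c) (u c) := by
  induction n generalizing t with
  | zero => exact measurable_const
  | succ n ih =>
    refine Measurable.add ?_ (ih ?_ ?_)
    · exact (StronglyMeasurable.integral_kernel_prod_right' (κ := (p t).comap x hx)
        hg.stronglyMeasurable).measurable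
    · exact (measurable_snoc t).comp (hx.prodMk ((measurable_pi_apply 0).comp hu))
    · exact measurable_pi_iff.2 fun i => (measurable_pi_apply i.succ).comp hu

theorem condSum_eq_sum (p : (t : ℕ) → Kernel (Fin t → α) α) (φ : α → ℝ) (y : ℕ → α) (n t : ℕ) :
    condSum p φ n t (fun i => y i) (fun i => y (t + i)) =
      ∑ i ∈ Finset.range n, ∫ v, φ v ∂(p (t + i) fun j => y j) := by
  induction n generalizing t with
  | zero => rfl
  | succ n ih =>
    rw [Finset.sum_range_succ', condSum, add_comm]
    have h1 : (Fin.snoc (fun i : Fin t => y i) (y (t + ((0 : Fin (n + 1)) : ℕ))) :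
        Fin (t + 1) → α) = fun i : Fin (t + 1) => y i := by
      funext i
      refine Fin.lastCases ?_ (fun j => ?_) i <;> simp
    have h2 : (Fin.tail fun i : Fin (n + 1) => y (t + i)) = fun i : Fin n => y (t + 1 + i) := by
      funext i
      simp [Fin.tail, add_comm, add_left_comm]
    rw [h1, h2, ih (t + 1)]
    congr 1
    refine Finset.sum_congr rfl fun i _ => ?_
    rw [show t + 1 + i = t + (i + 1) by ring]

theorem ofReal_exp_integral_le (ν : Measure α) [IsProbabilityMeasure ν] {φ : α → ℝ}
    (hφ : Measurable φ) {C : ℝ} (hC : ∀ v, |φ v| ≤ C) (l : ℝ) :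
    ENNReal.ofReal (Real.exp (l * ∫ v, φ v ∂ν)) ≤
      ∫⁻ v, ENNReal.ofReal (Real.exp (l * φ v)) ∂ν := by
  have hi : Integrable (fun v => l * φ v) ν :=
    (Integrable.of_bound hφ.aestronglyMeasurable C (.of_forall hC)).const_mul l
  have hie : Integrable (fun v => Real.exp (l * φ v)) ν := by
    refine Integrable.of_bound (hφ.const_mul l).exp.aestronglyMeasurable
      (Real.exp (|l| * C)) (.of_forall fun v => ?_)
    rw [Real.norm_eq_abs, Real.abs_exp]
    refine Real.exp_le_exp.2 ((le_abs_self _).trans ?_)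
    rw [abs_mul]
    exact mul_le_mul_of_nonneg_left (hC v) (abs_nonneg l)
  rw [← ofReal_integral_eq_lintegral_ofReal hie (.of_forall fun v => (Real.exp_pos _).le),
    ← integral_const_mul]
  exact ENNReal.ofReal_le_ofReal (convexOn_exp.map_integral_le Real.continuous_exp.continuousOn
    isClosed_univ (.of_forall fun v => Set.mem_univ _) hi hie)

/-- Jensen's inequality for the tangent sequence: the conditional expectations can be replaced by
the values at the second components of the pairs. -/
theorem lintegral_exp_condSum_le (p : (t : ℕ) → Kernel (Fin t → α) α)
    [∀ t, IsMarkovKernel (p t)] (l : ℝ) {C : ℝ} {n : ℕ} (t : ℕ) (x : Fin t → α)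
    {g : (Fin n → α) × α → ℝ} (hg : Measurable g) (hC : ∀ z, |g z| ≤ C)
    {E : (Fin n → α) → ℝ≥0∞} (hE : Measurable E) :
    ∫⁻ τ, E (fun i => (τ.label (fun _ => true) i).1) *
        ENNReal.ofReal (Real.exp (l * condSum p
          (fun v => g (fun i => (τ.label (fun _ => true) i).1, v)) n t x
          fun i => (τ.label (fun _ => true) i).1)) ∂(treeKernel p n t x) ≤
      ∫⁻ τ, E (fun i => (τ.label (fun _ => true) i).1) *
        ENNReal.ofReal (Real.exp (l * ∑ i, g (fun i => (τ.label (fun _ => true) i).1,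
          (τ.label (fun _ => true) i).2))) ∂(treeKernel p n t x) := by
  induction n generalizing t with
  | zero => simp [condSum]
  | succ n ih =>
    have hlab := fun m : ℕ => BTree.measurable_label (α := α × α) (n := m) (fun _ => true)
    have hfst : ∀ m : ℕ, Measurable fun τ : BTree (α × α) m =>
        fun i => (τ.label (fun _ => true) i).1 := fun m =>
      measurable_pi_iff.2 fun i => measurable_fst.comp ((measurable_pi_apply i).comp (hlab m))
    have hsnd : ∀ (m : ℕ) (i), Measurable fun τ : BTree (α × α) m =>
        (τ.label (fun _ => true) i).2 := fun m i =>
      measurable_snd.comp ((measurable_pi_apply i).comp (hlab m))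
    rw [lintegral_treeKernel_succ p n t x (Q := fun τ =>
        E (fun i => (τ.label (fun _ => true) i).1) *
        ENNReal.ofReal (Real.exp (l * condSum p
          (fun v => g (fun i => (τ.label (fun _ => true) i).1, v)) (n + 1) t x
          fun i => (τ.label (fun _ => true) i).1))) ?_,
      lintegral_treeKernel_succ p n t x (Q := fun τ =>
        E (fun i => (τ.label (fun _ => true) i).1) *
        ENNReal.ofReal (Real.exp (l * ∑ i, g
          (fun i => (τ.label (fun _ => true) i).1,
            (τ.label (fun _ => true) i).2)))) ?_]
    rotate_left
    · refine (hE.comp (hfst (n + 1))).mul (ENNReal.measurable_ofReal.comp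
        (Measurable.exp (Measurable.const_mul (Finset.measurable_fun_sum _ fun i _ => ?_) l)))
      exact hg.comp ((hfst (n + 1)).prodMk (hsnd (n + 1) i))
    · refine (hE.comp (hfst (n + 1))).mul (ENNReal.measurable_ofReal.comp
        (Measurable.exp (Measurable.const_mul ?_ l)))
      exact measurable_condSum p (γ := BTree (α × α) (n + 1))
        (g := fun z => g (fun i => (z.1.label (fun _ => true) i).1, z.2))
        (hg.comp (((hfst (n + 1)).comp measurable_fst).prodMk measurable_snd))
        measurable_const (hfst (n + 1))
    have htail : (Fin.tail fun _ : Fin (n + 1) => true) = fun _ => true := rfl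
    have hc : ∀ (u v : α) (w : Fin n → α × α),
        (fun i => (Fin.cons (α := fun _ => α × α) (u, v) w i).1) =
          (Fin.cons u fun i => (w i).1 : Fin (n + 1) → α) := by
      intro u v w
      funext i
      refine Fin.cases ?_ (fun j => ?_) i <;> simp
    simp only [BTree.label_node, if_true, htail, hc, condSum, lintegral_const, measure_univ,
      mul_one, Fin.sum_univ_succ, Fin.cons_zero, Fin.cons_succ, Fin.tail_cons, mul_add,
      Real.exp_add, ENNReal.ofReal_mul (Real.exp_pos _).le, ← mul_assoc]
    refine lintegral_mono fun u => ?_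
    have hcu : Measurable fun w : Fin n → α => (Fin.cons u w : Fin (n + 1) → α) :=
      (measurable_fin_cons n).comp measurable_prodMk_left
    have hgu : Measurable fun z : (Fin n → α) × α => g (Fin.cons u z.1, z.2) :=
      hg.comp ((hcu.comp measurable_fst).prodMk measurable_snd)
    -- The current conditional expectation is absorbed into the weight, which may depend on the
    -- whole path of first components. This is why the statement carries a general `E`.
    have hEu : Measurable fun w : Fin n → α => E (Fin.cons u w) *
        ENNReal.ofReal (Real.exp (l * ∫ v, g (Fin.cons u w, v) ∂(p t x))) :=
      (hE.comp hcu).mul (ENNReal.measurable_ofReal.comp (Measurable.exp (Measurable.const_mul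
        hgu.stronglyMeasurable.integral_prod_right'.measurable l)))
    refine (ih (t + 1) (Fin.snoc x u) hgu (fun z => hC _) hEu).trans ?_
    -- The second component `v` does not influence the subtree after `+1`, so it can be integrated
    -- innermost, with the function held fixed; Jensen then applies.
    rw [lintegral_lintegral_swap]
    · refine lintegral_mono fun τ => ?_
      simp only
      have hm : Measurable fun v => ENNReal.ofReal (Real.exp
          (l * g (Fin.cons u fun i => (τ.label (fun _ => true) i).1, v))) :=
        ENNReal.measurable_ofReal.comp (Measurable.exp (Measurable.const_mul
          (hg.comp measurable_prodMk_left) l))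
      rw [lintegral_mul_const _ (hm.const_mul _), lintegral_const_mul _ hm]
      gcongr
      exact ofReal_exp_integral_le (p t x) (φ := fun v => g (_, v))
        (hg.comp measurable_prodMk_left) (fun v => hC _) l
    · refine Measurable.aemeasurable (Measurable.mul (Measurable.mul ?_ ?_) ?_)
      · exact hE.comp (hcu.comp ((hfst n).comp measurable_snd))
      · exact ENNReal.measurable_ofReal.comp (Measurable.exp (Measurable.const_mul
          (hgu.comp (((hfst n).comp measurable_snd).prodMk measurable_fst)) l))
      · refine ENNReal.measurable_ofReal.comp
          (Measurable.exp (Measurable.const_mul (Finset.measurable_fun_sum _ fun i _ => ?_) l))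
        exact hgu.comp (((hfst n).comp measurable_snd).prodMk ((hsnd n i).comp measurable_snd))

end TreeKernel

/-! ### The law of the process as the law of a branch. -/

section Observations

theorem measurable_history {Ω α : Type*} [MeasurableSpace Ω] [MeasurableSpace α] {Z : ℕ → Ω → α}
    (hZ : ∀ t, Measurable (Z t)) (t : ℕ) : Measurable (history Z t) :=
  measurable_pi_iff.2 fun i => hZ i

theorem snoc_history {Ω α : Type*} {Z : ℕ → Ω → α} (t : ℕ) (ω : Ω) :
    (Fin.snoc (history Z t ω) (Z t ω) : Fin (t + 1) → α) = history Z (t + 1) ω := by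
  funext i
  refine Fin.lastCases ?_ (fun j => ?_) i <;> simp [history]

variable {Ω α : Type*} [MeasurableSpace Ω] [MeasurableSpace α] [StandardBorelSpace α] [Nonempty α]
  (P : Measure Ω) [IsProbabilityMeasure P] {Z : ℕ → Ω → α}

theorem lintegral_condLaw (hZ : ∀ t, Measurable (Z t)) (t : ℕ) {F : (Fin t → α) × α → ℝ≥0∞}
    (hF : Measurable F) :
    ∫⁻ ω, F (history Z t ω, Z t ω) ∂P =
      ∫⁻ ω, ∫⁻ z, F (history Z t ω, z) ∂(condLaw P Z t (history Z t ω)) ∂P := by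
  have hh := measurable_history hZ t
  rw [← lintegral_map hF (hh.prodMk (hZ t)), ← compProd_map_condDistrib (hZ t).aemeasurable,
    Measure.lintegral_compProd hF, lintegral_map _ hh]
  · rfl
  · exact hF.lintegral_kernel_prod_right'

/-- The observations have the law of the first components of the pairs met along the path of signs
`+1` of a random tree. -/
theorem lintegral_history_eq (hZ : ∀ t, Measurable (Z t)) (n t : ℕ)
    {F : (Fin t → α) × (Fin n → α) → ℝ≥0∞} (hF : Measurable F) :
    ∫⁻ ω, F (history Z t ω, fun i => Z (t + i) ω) ∂P =
      ∫⁻ ω, ∫⁻ τ, F (history Z t ω, fun i => (τ.label (fun _ => true) i).1)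
        ∂(treeKernel (condLaw P Z) n t (history Z t ω)) ∂P := by
  induction n generalizing t with
  | zero =>
    refine lintegral_congr fun ω => ?_
    have : ∀ τ : BTree (α × α) 0, (fun i => (τ.label (fun _ => true) i).1) =
        fun i : Fin 0 => Z (t + i) ω := fun τ => Subsingleton.elim _ _
    simp [this]
  | succ n ih =>
    have hlab : ∀ m : ℕ, Measurable fun τ : BTree (α × α) m =>
        fun i => (τ.label (fun _ => true) i).1 := fun m =>
      measurable_pi_iff.2 fun i => measurable_fst.comp
        ((measurable_pi_apply i).comp (BTree.measurable_label _))
    have hG : Measurable fun y : ((Fin t → α) × α) × (Fin n → α) =>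
        F (y.1.1, Fin.cons y.1.2 y.2) :=
      hF.comp ((measurable_fst.comp measurable_fst).prodMk ((measurable_fin_cons n).comp
        ((measurable_snd.comp measurable_fst).prodMk measurable_snd)))
    have hsplit : Measurable fun y : Fin (t + 1) → α => ((fun i => y i.castSucc, y (Fin.last t)) :
        (Fin t → α) × α) :=
      (measurable_pi_iff.2 fun i => measurable_pi_apply _).prodMk (measurable_pi_apply _)
    have hc : ∀ ω, (Fin.cons (Z t ω) fun i : Fin n => Z (t + 1 + i) ω : Fin (n + 1) → α) =
        fun i : Fin (n + 1) => Z (t + i) ω := by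
      intro ω
      funext i
      refine Fin.cases ?_ (fun j => ?_) i
      · simp
      · simp [add_comm, add_left_comm]
    have h1 : ∫⁻ ω, F (history Z t ω, Fin.cons (Z t ω) fun i : Fin n => Z (t + 1 + i) ω) ∂P =
        ∫⁻ ω, ∫⁻ τ, F (history Z t ω, Fin.cons (Z t ω) fun i => (τ.label (fun _ => true) i).1)
          ∂(treeKernel (condLaw P Z) n (t + 1) (history Z (t + 1) ω)) ∂P :=
      ih (t + 1) (hG.comp ((hsplit.comp measurable_fst).prodMk measurable_snd))
    simp only [hc] at h1
    rw [h1]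
    simp only [← snoc_history]
    rw [lintegral_condLaw P hZ t (F := fun y => ∫⁻ τ, F (y.1, Fin.cons y.2
      fun i => (τ.label (fun _ => true) i).1)
        ∂(treeKernel (condLaw P Z) n (t + 1) (Fin.snoc y.1 y.2)))
      (measurable_lintegral_comp _ (measurable_snoc t)
        (hG.comp (measurable_fst.prodMk ((hlab n).comp measurable_snd))))]
    refine lintegral_congr fun ω => ?_
    rw [lintegral_treeKernel_succ (condLaw P Z) n t _ (Q := fun τ => F (history Z t ω,
        fun i => (τ.label (fun _ => true) i).1))
        (hF.comp (measurable_const.prodMk (hlab (n + 1))))]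
    refine lintegral_congr fun u => ?_
    have hc' : ∀ (v : α) (w : Fin n → α × α),
        (fun i => (Fin.cons (α := fun _ => α × α) (u, v) w i).1) =
          (Fin.cons u fun i => (w i).1 : Fin (n + 1) → α) := by
      intro v w
      funext i
      refine Fin.cases ?_ (fun j => ?_) i <;> simp
    have htail : (Fin.tail fun _ : Fin (n + 1) => true) = fun _ => true := rfl
    simp only [BTree.label_node, if_true, htail, hc', lintegral_const, measure_univ, mul_one]

end Observations

/-! ### Hoeffding bounds on trees and sequential covers. -/

section Covering

theorem BTree.label_map {α β : Type*} (g : α → β) {n : ℕ} (z : BTree α n) (σ : Fin n → Bool)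
    (t : Fin n) : (z.map g).label σ t = g (z.label σ t) := by
  induction n with
  | zero => exact t.elim0
  | succ n ih =>
    obtain ⟨x, l, r, rfl⟩ : ∃ x l r, z = BTree.node x l r := ⟨z.1, z.2.1, z.2.2, rfl⟩
    have h : (BTree.node x l r).map g = BTree.node (g x) (l.map g) (r.map g) := rfl
    rw [h, BTree.label_node, BTree.label_node]
    refine Fin.cases rfl (fun j => ?_) t
    simp only [Fin.cons_succ]
    cases hσ : σ 0
    · exact ih r (Fin.tail σ) j
    · exact ih l (Fin.tail σ) j

/-- The sign `+1` or `-1` coded by a Boolean. -/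
def boolSign (b : Bool) : ℝ := cond b 1 (-1)

theorem abs_boolSign (b : Bool) : |boolSign b| = 1 := by
  cases b <;> simp [boolSign]

theorem boolSign_not (b : Bool) : boolSign (!b) = -boolSign b := by
  cases b <;> simp [boolSign]

theorem sum_fin_succ_bool {M : Type*} [AddCommMonoid M] {n : ℕ}
    (F : (Fin (n + 1) → Bool) → M) :
    ∑ σ, F σ = ∑ σ : Fin n → Bool, F (Fin.cons true σ) + ∑ σ : Fin n → Bool, F (Fin.cons false σ) := by
  rw [← (Fin.consEquiv fun _ : Fin (n + 1) => Bool).sum_comp, Fintype.sum_prod_type,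
    Fintype.sum_bool]
  rfl

/-- The exponential moments of the signed sum of the labels along a random path of a tree. -/
theorem sum_exp_label_le {n : ℕ} (v : BTree ℝ n) {C : ℝ}
    (hv : ∀ σ t, |v.label σ t| ≤ C) (θ : ℝ) :
    ∑ σ : Fin n → Bool, Real.exp (θ * ∑ t, boolSign (σ t) * v.label σ t) ≤
      2 ^ n * Real.exp (n * (θ ^ 2 * C ^ 2 / 2)) := by
  induction n with
  | zero => simp
  | succ n ih =>
    obtain ⟨x, l, r, rfl⟩ : ∃ x l r, v = BTree.node x l r := ⟨v.1, v.2.1, v.2.2, rfl⟩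
    have hl := ih l fun σ t => by
      simpa [BTree.label_node] using hv (Fin.cons true σ) t.succ
    have hr := ih r fun σ t => by
      simpa [BTree.label_node] using hv (Fin.cons false σ) t.succ
    have hx : |x| ≤ C := by simpa [BTree.label_node] using hv (fun _ => true) 0
    rw [sum_fin_succ_bool]
    simp only [BTree.label_node, Fin.sum_univ_succ, Fin.cons_zero, Fin.cons_succ, Fin.tail_cons,
      if_true, Bool.false_eq_true, if_false, mul_add, Real.exp_add, ← Finset.mul_sum, boolSign,
      cond_true, cond_false] at hl hr ⊢
    -- The root label precedes the first sign, so both signs meet the same `x` and average to a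
    -- hyperbolic cosine.
    have hcosh : Real.exp (θ * x) + Real.exp (-(θ * x)) ≤ 2 * Real.exp (θ ^ 2 * C ^ 2 / 2) := by
      have h1 := Real.cosh_le_exp_half_sq (θ * x)
      rw [Real.cosh_eq] at h1
      have h2 : Real.exp ((θ * x) ^ 2 / 2) ≤ Real.exp (θ ^ 2 * C ^ 2 / 2) := by
        rw [mul_pow, ← sq_abs x]
        gcongr
      linarith
    calc _ ≤ Real.exp (θ * (1 * x)) * (2 ^ n * Real.exp (n * (θ ^ 2 * C ^ 2 / 2))) +
          Real.exp (θ * (-1 * x)) * (2 ^ n * Real.exp (n * (θ ^ 2 * C ^ 2 / 2))) := by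
          gcongr
      _ = (Real.exp (θ * x) + Real.exp (-(θ * x))) *
          (2 ^ n * Real.exp (n * (θ ^ 2 * C ^ 2 / 2))) := by
          rw [one_mul, neg_one_mul, mul_neg, add_mul]
      _ ≤ 2 * Real.exp (θ ^ 2 * C ^ 2 / 2) * (2 ^ n * Real.exp (n * (θ ^ 2 * C ^ 2 / 2))) := by
          gcongr
      _ = _ := by
          rw [pow_succ, Nat.cast_succ, add_mul, Real.exp_add, one_mul]
          ring

/-- Covering trees may have arbitrarily large labels. Clipping them to `[-C, C]` brings them no
farther from functions bounded by `C` and makes the Hoeffding bound applicable. -/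
theorem abs_clamp_sub_le {C x y : ℝ} (hy : |y| ≤ C) : |max (-C) (min x C) - y| ≤ |x - y| := by
  have := abs_le.1 hy
  rcases max_cases (-C) (min x C) with h | h <;> rcases min_cases x C with h' | h' <;>
    rw [abs_le] <;> constructor <;> cases abs_cases (x - y) <;> linarith

theorem abs_clamp_le {C : ℝ} (hC : 0 ≤ C) (x : ℝ) : |max (-C) (min x C)| ≤ C :=
  abs_le.2 ⟨le_max_left _ _, max_le (by linarith) (min_le_right _ _)⟩

/-- Exponential moments of signed sums along a random path, for functions of a class chosen
according to the path, in terms of a finite sequential cover of the class. -/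
theorem sum_exp_le_ncard_mul {α : Type*} {n : ℕ} {w : Fin n → ℝ} {a C : ℝ} (hC : 0 ≤ C)
    {𝒢 : Set (α → ℝ)} (h𝒢 : ∀ g ∈ 𝒢, ∀ z, |g z| ≤ C) {z : BTree α n} {V : Set (BTree ℝ n)}
    (hV : IsSeqCover w a 𝒢 z V) (hfin : V.Finite) {γ : (Fin n → Bool) → α → ℝ}
    (hγ : ∀ σ, γ σ ∈ 𝒢) (θ : ℝ) :
    ∑ σ, Real.exp (θ * ∑ t, boolSign (σ t) * γ σ (z.label σ t)) ≤
      V.ncard * (2 ^ n * Real.exp (|θ| * (‖w‖⁻¹ * a) + n * (θ ^ 2 * C ^ 2 / 2))) := by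
  let c : ℝ → ℝ := fun x => max (-C) (min x C)
  let Φ : (Fin n → Bool) → BTree ℝ n → ℝ := fun σ v => Real.exp (|θ| * (‖w‖⁻¹ * a)) *
    Real.exp (θ * ∑ t, boolSign (σ t) * (v.map c).label σ t)
  have hΦ : ∀ σ v, 0 ≤ Φ σ v := fun σ v => mul_nonneg (Real.exp_pos _).le (Real.exp_pos _).le
  -- The covering tree depends on `σ`. Bounding its term by the sum over all of `V` leaves only
  -- trees fixed in advance, so that the sums can be interchanged.
  have hterm : ∀ σ, Real.exp (θ * ∑ t, boolSign (σ t) * γ σ (z.label σ t)) ≤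
      ∑ v ∈ hfin.toFinset, Φ σ v := by
    intro σ
    obtain ⟨v, hvV, hv⟩ := hV (γ σ) (hγ σ) σ
    refine le_trans ?_ (Finset.single_le_sum (f := Φ σ)
      (fun v _ => hΦ σ v) (hfin.mem_toFinset.2 hvV))
    simp only [Φ]
    rw [← Real.exp_add, Real.exp_le_exp, ← sub_le_iff_le_add, ← mul_sub,
      ← Finset.sum_sub_distrib]
    refine (le_abs_self _).trans ?_
    rw [abs_mul]
    refine mul_le_mul_of_nonneg_left ?_ (abs_nonneg θ)
    refine ((Finset.abs_sum_le_sum_abs _ _).trans (Finset.sum_le_sum fun t _ => ?_)).trans hv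
    rw [← mul_sub, abs_mul, abs_boolSign, one_mul, BTree.label_map, abs_sub_comm]
    exact abs_clamp_sub_le (h𝒢 _ (hγ σ) _)
  calc _ ≤ ∑ σ, ∑ v ∈ hfin.toFinset, Φ σ v :=
        Finset.sum_le_sum fun σ _ => hterm σ
    _ = ∑ v ∈ hfin.toFinset, Real.exp (|θ| * (‖w‖⁻¹ * a)) *
        ∑ σ : Fin n → Bool, Real.exp (θ * ∑ t, boolSign (σ t) * (v.map c).label σ t) := by
        rw [Finset.sum_comm]
        simp only [Φ, Finset.mul_sum]
    _ ≤ ∑ v ∈ hfin.toFinset, Real.exp (|θ| * (‖w‖⁻¹ * a)) *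
        (2 ^ n * Real.exp (n * (θ ^ 2 * C ^ 2 / 2))) := by
        refine Finset.sum_le_sum fun v _ => mul_le_mul_of_nonneg_left ?_ (Real.exp_pos _).le
        refine sum_exp_label_le _ (fun σ t => ?_) θ
        rw [BTree.label_map]
        exact abs_clamp_le hC _
    _ = _ := by
        rw [Finset.sum_const, nsmul_eq_mul, ← Set.ncard_eq_toFinset_card V hfin, Real.exp_add]
        ring

theorem exists_isSeqCover_encard_eq {α : Type*} {n : ℕ} (w : Fin n → ℝ) (a : ℝ)
    (𝒢 : Set (α → ℝ)) (z : BTree α n) (h : seqCoveringNumber w a 𝒢 z ≠ ⊤) :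
    ∃ V, IsSeqCover w a 𝒢 z V ∧ V.encard = seqCoveringNumber w a 𝒢 z := by
  have hne : {V : Set (BTree ℝ n) | IsSeqCover w a 𝒢 z V}.Nonempty := by
    by_contra hemp
    rw [Set.not_nonempty_iff_eq_empty] at hemp
    exact h (by simp [seqCoveringNumber, hemp])
  have := csInf_mem (hne.image Set.encard)
  rw [sInf_image] at this
  exact this

/-- The bound of `sum_exp_le_ncard_mul` in terms of the sequential covering number. -/
theorem ofReal_average_exp_le {α : Type*} {n : ℕ} (w : Fin n → ℝ) (a : ℝ) {C : ℝ} (hC : 0 ≤ C)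
    {𝒢 : Set (α → ℝ)} (h𝒢 : ∀ g ∈ 𝒢, ∀ z, |g z| ≤ C) (z : BTree α n)
    {γ : (Fin n → Bool) → α → ℝ} (hγ : ∀ σ, γ σ ∈ 𝒢) (θ : ℝ) :
    ∑ σ, ENNReal.ofReal (Real.exp (θ * ∑ t, boolSign (σ t) * γ σ (z.label σ t))) ≤
      (seqCoveringNumber w a 𝒢 z : ℝ≥0∞) * (2 ^ n * ENNReal.ofReal
        (Real.exp (|θ| * (‖w‖⁻¹ * a) + n * (θ ^ 2 * C ^ 2 / 2)))) := by
  rw [← ENNReal.ofReal_sum_of_nonneg fun σ _ => (Real.exp_pos _).le]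
  by_cases h : seqCoveringNumber w a 𝒢 z = ⊤
  · rw [h, ENat.toENNReal_top, ENNReal.top_mul]
    · exact le_top
    · simp [Real.exp_pos]
  · obtain ⟨V, hV, hcard⟩ := exists_isSeqCover_encard_eq w a 𝒢 z h
    have hfin : V.Finite := Set.encard_ne_top_iff.1 (hcard ▸ h)
    refine (ENNReal.ofReal_le_ofReal (sum_exp_le_ncard_mul hC h𝒢 hV hfin hγ θ)).trans_eq ?_
    rw [← hcard, ← hfin.cast_ncard_eq, ENNReal.ofReal_mul (Nat.cast_nonneg _),
      ENNReal.ofReal_mul (by positivity), ENNReal.ofReal_natCast, ENat.toENNReal_coe,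
      ENNReal.ofReal_pow (by norm_num)]
    simp

theorem one_le_seqCoveringNumber {α : Type*} {n : ℕ} (w : Fin n → ℝ) (a : ℝ)
    {𝒢 : Set (α → ℝ)} (h𝒢 : 𝒢.Nonempty) (z : BTree α n) : 1 ≤ seqCoveringNumber w a 𝒢 z := by
  refine le_iInf₂ fun V hV => ?_
  obtain ⟨g, hg⟩ := h𝒢
  obtain ⟨v, hv, -⟩ := hV g hg fun _ => true
  exact Set.one_le_encard_iff_nonempty.2 ⟨v, hv⟩

/-- The trees with labels in `S`. -/
def BTree.labeledIn {β : Type*} (S : Set β) : (n : ℕ) → Set (BTree β n)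
  | 0 => Set.univ
  | n + 1 => S ×ˢ (BTree.labeledIn S n ×ˢ BTree.labeledIn S n)

theorem BTree.finite_labeledIn {β : Type*} {S : Set β} (hS : S.Finite) (n : ℕ) :
    (BTree.labeledIn S n).Finite := by
  induction n with
  | zero => exact Set.finite_univ (α := PUnit)
  | succ n ih => exact hS.prod (ih.prod ih)

theorem BTree.map_mem_labeledIn {α β : Type*} {S : Set β} {g : α → β} (hg : ∀ x, g x ∈ S) {n : ℕ}
    (z : BTree α n) : z.map g ∈ BTree.labeledIn S n := by
  induction n with
  | zero => trivial
  | succ n ih => exact ⟨hg _, ih _, ih _⟩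

/-- The sequential covering numbers of a uniformly bounded class are bounded. -/
theorem exists_seqCoveringNumber_le {α : Type*} {n : ℕ} {w : Fin n → ℝ} {a C : ℝ}
    (ha : 0 < ‖w‖⁻¹ * a) {𝒢 : Set (α → ℝ)} (h𝒢 : ∀ g ∈ 𝒢, ∀ z, |g z| ≤ C) :
    ∃ K : ℕ, ∀ z : BTree α n, seqCoveringNumber w a 𝒢 z ≤ K := by
  obtain ⟨ε, hε, hεn⟩ : ∃ ε : ℝ, 0 < ε ∧ n * ε ≤ ‖w‖⁻¹ * a := by
    refine ⟨‖w‖⁻¹ * a / (n + 1), by positivity, ?_⟩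
    rw [mul_div_assoc', div_le_iff₀ (by positivity)]
    nlinarith
  -- Rounding down to multiples of `ε` leaves finitely many labels, and finitely many trees with
  -- such labels form a cover.
  let r : ℝ → ℝ := fun y => ε * ⌊y / ε⌋
  have hr : ∀ y, |r y - y| ≤ ε := by
    intro y
    have h1 : ε * ⌊y / ε⌋ ≤ y := by
      have := mul_le_mul_of_nonneg_left (Int.floor_le (y / ε)) hε.le
      rwa [mul_div_cancel₀ _ hε.ne'] at this
    have h2 : y ≤ ε * (⌊y / ε⌋ + 1) := by
      have := mul_le_mul_of_nonneg_left (Int.lt_floor_add_one (y / ε)).le hε.le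
      rwa [mul_div_cancel₀ _ hε.ne'] at this
    rw [abs_le]
    constructor <;> simp only [r] <;> linarith
  let S : Set ℝ := (fun k : ℤ => ε * k) '' Set.Icc ⌊-C / ε⌋ ⌊C / ε⌋
  have hS : S.Finite := (Set.finite_Icc _ _).image _
  have hrS : ∀ g ∈ 𝒢, ∀ x, r (g x) ∈ S := by
    intro g hg x
    have := abs_le.1 (h𝒢 g hg x)
    refine ⟨⌊g x / ε⌋, ⟨Int.floor_mono ?_, Int.floor_mono ?_⟩, rfl⟩
    · exact (div_le_div_iff_of_pos_right hε).2 this.1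
    · exact (div_le_div_iff_of_pos_right hε).2 this.2
  refine ⟨(BTree.labeledIn S n).ncard, fun z => ?_⟩
  rw [(BTree.finite_labeledIn hS n).cast_ncard_eq]
  refine iInf₂_le _ fun g hg σ => ⟨z.map fun x => r (g x),
    BTree.map_mem_labeledIn (hrS g hg) z, ?_⟩
  refine (Finset.sum_le_sum fun t _ => ?_).trans ((Finset.sum_const ε).trans_le ?_)
  · rw [BTree.label_map]
    exact hr _
  · simpa using hεn

variable {α : Type*} [MeasurableSpace α] (p : (t : ℕ) → Kernel (Fin t → α) α)
  [∀ t, IsMarkovKernel (p t)]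

/-- This makes the logarithm in the threshold nonnegative when `δ < 1`. -/
theorem one_le_expectedCoveringNumber {n : ℕ} (w : Fin n → ℝ) (a : ℝ) {𝒢 : Set (α → ℝ)}
    (h𝒢 : 𝒢.Nonempty) : 1 ≤ expectedCoveringNumber p w a 𝒢 := by
  calc (1 : ℝ≥0∞) = ∫⁻ _, 1 ∂(treeKernel p n 0 Fin.elim0) := by simp
    _ ≤ _ := lintegral_mono fun τ => by
      simpa using ENat.toENNReal_le.2 (one_le_seqCoveringNumber w a h𝒢 (τ.map Prod.fst))

/-- Finiteness makes `toReal` faithful in the threshold; an infinite value would be read as `0`. -/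
theorem expectedCoveringNumber_ne_top {n : ℕ} {w : Fin n → ℝ} {a C : ℝ}
    (ha : 0 < ‖w‖⁻¹ * a) {𝒢 : Set (α → ℝ)} (h𝒢 : ∀ g ∈ 𝒢, ∀ z, |g z| ≤ C) :
    expectedCoveringNumber p w a 𝒢 ≠ ⊤ := by
  obtain ⟨K, hK⟩ := exists_seqCoveringNumber_le (n := n) ha h𝒢
  refine ne_top_of_le_ne_top (ENNReal.natCast_ne_top K) ?_
  calc expectedCoveringNumber p w a 𝒢 ≤ ∫⁻ _, K ∂(treeKernel p n 0 Fin.elim0) :=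
        lintegral_mono fun τ => by
          simpa using ENat.toENNReal_le.2 (hK (τ.map Prod.fst))
    _ = K := by simp

end Covering

/-! ### Symmetrization, Chernoff bound and uniformity in the scale. -/

section Concentration

/-- The weight of the first components in the symmetrized exponential moment, for a function
chosen by `s` according to the observations along the path. -/
def firstMoment {α W : Type*} {n : ℕ} (g : W × α → ℝ) (s : (Fin n → α) → W) (l : ℝ)
    (σ : Fin n → Bool) (w : Fin n → α × α) : ℝ≥0∞ :=
  ENNReal.ofReal (Real.exp (-2 * l * ∑ i, boolSign (σ i) *
    g (s fun j => (signSwap σ w j).1, (w i).1)))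

variable {α W : Type*} [MeasurableSpace α] [MeasurableSpace W] {n : ℕ} {g : W × α → ℝ}
  {s : (Fin n → α) → W}

theorem measurable_firstMoment (hg : Measurable g) (hs : Measurable s) (l : ℝ)
    (σ : Fin n → Bool) : Measurable (firstMoment g s l σ) := by
  refine ENNReal.measurable_ofReal.comp (Measurable.exp (Measurable.const_mul
    (Finset.measurable_fun_sum _ fun i _ => Measurable.const_mul (hg.comp (Measurable.prodMk
      (hs.comp (measurable_pi_iff.2 fun j => ?_)) ?_)) _) _))
  · exact measurable_fst.comp ((measurable_pi_apply j).comp (measurable_signSwap σ))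
  · exact measurable_fst.comp (measurable_pi_apply i)

/-- With `A` and `B` the signed sums over first and second components, the exponent is `l * (B -
A)`, and `2xy ≤ x² + y²` splits its exponential. The term in `B` is again a `firstMoment`, for
opposite signs and swapped pairs: the selected function is the same, since both exchanges give the
same path. -/
theorem two_mul_exp_signSwap_le {α W : Type*} {n : ℕ} (g : W × α → ℝ) (s : (Fin n → α) → W) (l : ℝ)
    (σ : Fin n → Bool) (w : Fin n → α × α) :
    2 * (ENNReal.ofReal (Real.exp (-l * ∑ i, g (s fun j => (signSwap σ w j).1,
        (signSwap σ w i).1))) *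
      ENNReal.ofReal (Real.exp (l * ∑ i, g (s fun j => (signSwap σ w j).1,
        (signSwap σ w i).2)))) ≤
      firstMoment g s l σ w + firstMoment g s l (fun i => !σ i) fun i => (w i).swap := by
  simp only [firstMoment, signSwap_not, Prod.swap_swap, Prod.fst_swap, boolSign_not]
  set x := s fun j => (signSwap σ w j).1
  set A := ∑ i, boolSign (σ i) * g (x, (w i).1)
  set B := ∑ i, boolSign (σ i) * g (x, (w i).2)
  have h1 : -l * ∑ i, g (x, (signSwap σ w i).1) + l * ∑ i, g (x, (signSwap σ w i).2) =
      -l * A + l * B := by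
    have : ∑ i, g (x, (signSwap σ w i).2) - ∑ i, g (x, (signSwap σ w i).1) = B - A := by
      simp only [A, B, ← Finset.sum_sub_distrib]
      refine Finset.sum_congr rfl fun i _ => ?_
      cases h : σ i <;> (simp [signSwap, h, boolSign]; try ring)
    linear_combination l * this
  have h2 : ∑ i, -boolSign (σ i) * g (x, (w i).2) = -B := by
    simp [B, Finset.sum_neg_distrib]
  rw [h2, ← ENNReal.ofReal_mul (Real.exp_pos _).le, ← Real.exp_add, h1,
    ← ENNReal.ofReal_add (Real.exp_pos _).le (Real.exp_pos _).le, ← ENNReal.ofReal_ofNat 2,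
    ← ENNReal.ofReal_mul (by norm_num)]
  refine ENNReal.ofReal_le_ofReal ?_
  have e1 : Real.exp (-2 * l * A) = Real.exp (-l * A) ^ 2 := by
    rw [← Real.exp_nat_mul]
    congr 1
    push_cast
    ring
  have e2 : Real.exp (-2 * l * -B) = Real.exp (l * B) ^ 2 := by
    rw [← Real.exp_nat_mul]
    congr 1
    push_cast
    ring
  rw [e1, e2, Real.exp_add]
  linarith [sq_nonneg (Real.exp (-l * A) - Real.exp (l * B))]

variable {Ω : Type*} [MeasurableSpace Ω]

/-- Symmetrization and covering: the exponential moments of the differences between the second and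
the first components along the path of signs `+1`. -/
theorem lintegral_exp_label_le (p : (t : ℕ) → Kernel (Fin t → α) α) [∀ t, IsMarkovKernel (p t)]
    (hg : Measurable g) (hs : Measurable s) {C : ℝ} (hC : 0 ≤ C) {𝒢 : Set (α → ℝ)}
    (hg𝒢 : ∀ w, (fun z => g (w, z)) ∈ 𝒢) (h𝒢 : ∀ φ ∈ 𝒢, ∀ z, |φ z| ≤ C) (w : Fin n → ℝ) (a l : ℝ) :
    ∫⁻ τ, ENNReal.ofReal (Real.exp (-l * ∑ i, g (s fun j => (τ.label (fun _ => true) j).1,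
          (τ.label (fun _ => true) i).1))) *
        ENNReal.ofReal (Real.exp (l * ∑ i, g (s fun j => (τ.label (fun _ => true) j).1,
          (τ.label (fun _ => true) i).2))) ∂(treeKernel p n 0 Fin.elim0) ≤
      expectedCoveringNumber p w a 𝒢 * ENNReal.ofReal
        (Real.exp (2 * |l| * (‖w‖⁻¹ * a) + n * ((2 * l) ^ 2 * C ^ 2 / 2))) := by
  let F : (Fin n → α × α) → ℝ≥0∞ := fun y =>
    ENNReal.ofReal (Real.exp (-l * ∑ i, g (s fun j => (y j).1, (y i).1))) *
      ENNReal.ofReal (Real.exp (l * ∑ i, g (s fun j => (y j).1, (y i).2)))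
  have hsm : Measurable fun y : Fin n → α × α => s fun j => (y j).1 :=
    hs.comp (measurable_pi_iff.2 fun j => measurable_fst.comp (measurable_pi_apply j))
  have hF : Measurable F := by
    refine (ENNReal.measurable_ofReal.comp (Measurable.exp (Measurable.const_mul
      (Finset.measurable_fun_sum _ fun i _ => hg.comp (hsm.prodMk
        (measurable_fst.comp (measurable_pi_apply i)))) _))).mul
      (ENNReal.measurable_ofReal.comp (Measurable.exp (Measurable.const_mul
      (Finset.measurable_fun_sum _ fun i _ => hg.comp (hsm.prodMk
        (measurable_snd.comp (measurable_pi_apply i)))) _)))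
  set ν := treeKernel p n 0 Fin.elim0
  let I : (Fin n → Bool) → ℝ≥0∞ := fun σ => ∫⁻ τ, firstMoment g s l σ (τ.label σ) ∂ν
  have hmeas : ∀ σ, Measurable fun τ : BTree (α × α) n => firstMoment g s l σ (τ.label σ) :=
    fun σ => (measurable_firstMoment hg hs l σ).comp (BTree.measurable_label σ)
  have hswap : ∀ σ : Fin n → Bool, Measurable fun y : Fin n → α × α =>
      firstMoment g s l (fun i => !σ i) fun i => (y i).swap := fun σ =>
    (measurable_firstMoment hg hs l _).comp (measurable_pi_iff.2 fun i =>
      measurable_swap.comp (measurable_pi_apply i))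
  have hpt : ∀ σ y, 2 * F (signSwap σ y) ≤ firstMoment g s l σ y +
      firstMoment g s l (fun i => !σ i) fun i => (y i).swap := two_mul_exp_signSwap_le g s l
  have hstep : ∀ σ, 2 * ∫⁻ τ, F (τ.label fun _ => true) ∂ν ≤ I σ + I fun i => !σ i := by
    intro σ
    have hI : ∫⁻ τ, firstMoment g s l (fun i => !σ i) (fun i => (τ.label σ i).swap) ∂ν =
        I fun i => !σ i := by
      rw [lintegral_label_eq_lintegral_swap p 0 Fin.elim0 σ (hswap σ)]
      simp only [Prod.swap_swap]
      rfl
    calc 2 * ∫⁻ τ, F (τ.label fun _ => true) ∂ν =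
          2 * ∫⁻ τ, F (signSwap σ (τ.label σ)) ∂ν := by
          rw [lintegral_signSwap_label p 0 Fin.elim0 σ hF]
      _ = ∫⁻ τ, 2 * F (signSwap σ (τ.label σ)) ∂ν :=
          (lintegral_const_mul' _ _ ENNReal.ofNat_ne_top).symm
      _ ≤ ∫⁻ τ, (firstMoment g s l σ (τ.label σ) +
          firstMoment g s l (fun i => !σ i) fun i => (τ.label σ i).swap) ∂ν :=
          lintegral_mono fun τ : BTree (α × α) n => hpt σ (τ.label σ)
      _ = I σ + I fun i => !σ i := by
          rw [lintegral_add_left (hmeas σ), hI]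
  -- Reversing all signs permutes the paths, so the two halves have equal sums.
  have hnot : ∑ σ : Fin n → Bool, I (fun i => !σ i) = ∑ σ, I σ :=
    (Equiv.piCongrRight fun _ : Fin n => Equiv.boolNot).sum_comp I
  have hsum : (2 : ℝ≥0∞) * (2 ^ n * ∫⁻ τ, F (τ.label fun _ => true) ∂ν) ≤ 2 * ∑ σ, I σ := by
    have h := Finset.sum_le_sum fun (σ : Fin n → Bool) (_ : σ ∈ Finset.univ) => hstep σ
    rw [Finset.sum_add_distrib, hnot, Finset.sum_const, ← two_mul] at h
    refine le_trans (le_of_eq ?_) h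
    simp [nsmul_eq_mul]
    ring
  have hcover : ∑ σ, I σ ≤ 2 ^ n * (expectedCoveringNumber p w a 𝒢 * ENNReal.ofReal
      (Real.exp (2 * |l| * (‖w‖⁻¹ * a) + n * ((2 * l) ^ 2 * C ^ 2 / 2)))) := by
    -- The covering number is not known to be measurable in the tree; only finite constants are
    -- moved across its integral.
    rw [← lintegral_finsetSum _ fun σ _ => hmeas σ, mul_left_comm, expectedCoveringNumber,
      ← lintegral_mul_const' _ _ (ENNReal.mul_ne_top (by simp) ENNReal.ofReal_ne_top)]
    refine lintegral_mono fun τ => ?_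
    -- With the tree of pairs fixed, the function selected varies with `σ` and also sees the second
    -- components. The cover only has to approximate it on the tree of first components.
    have h := ofReal_average_exp_le w a hC h𝒢 (τ.map Prod.fst)
      (γ := fun σ z => g (s fun j => (signSwap σ (τ.label σ) j).1, z)) (fun σ => hg𝒢 _) (-2 * l)
    simp only [BTree.label_map] at h
    have e1 : |-2 * l| = 2 * |l| := by simp [abs_mul]
    have e2 : (-2 * l) ^ 2 = (2 * l) ^ 2 := by ring
    rw [e1, e2] at h
    exact h
  have h2 := (ENNReal.mul_le_mul_iff_right (by norm_num) (by norm_num)).1 hsum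
  exact (ENNReal.mul_le_mul_iff_right (by simp) (by simp)).1 (h2.trans hcover)

theorem condSum_zero (p : (t : ℕ) → Kernel (Fin t → α) α) (n t : ℕ) (x : Fin t → α)
    (u : Fin n → α) : condSum p (fun _ => 0) n t x u = 0 := by
  induction n generalizing t with
  | zero => rfl
  | succ n ih => simp [condSum, ih]

/-- The deviation of the sum of the values from the sum of the conditional expectations. -/
def deviation (p : (t : ℕ) → Kernel (Fin t → α) α) (φ : α → ℝ) {n : ℕ} (u : Fin n → α) : ℝ :=
  condSum p φ n 0 Fin.elim0 u - ∑ i, φ (u i)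

theorem measurable_deviation (p : (t : ℕ) → Kernel (Fin t → α) α) [∀ t, IsMarkovKernel (p t)]
    (hg : Measurable g) {γ : Type*} [MeasurableSpace γ] {r : γ → W} (hr : Measurable r)
    {u : γ → Fin n → α} (hu : Measurable u) :
    Measurable fun c => deviation p (fun v => g (r c, v)) (u c) :=
  (measurable_condSum p (g := fun z => g (r z.1, z.2))
    (hg.comp ((hr.comp measurable_fst).prodMk measurable_snd)) measurable_const hu).sub
    (Finset.measurable_fun_sum _ fun i _ =>
      hg.comp (hr.prodMk ((measurable_pi_apply i).comp hu)))

variable [StandardBorelSpace α] [Nonempty α] (P : Measure Ω) [IsProbabilityMeasure P]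
  {Z : ℕ → Ω → α}

/-- Along the all-plus branch the observed values form the weight `E` of `lintegral_exp_condSum_le`,
leaving the difference between second and first components to be symmetrized. -/
theorem lintegral_exp_deviation_le (hZ : ∀ t, Measurable (Z t))
    (hg : Measurable g) (hs : Measurable s) {C : ℝ} (hC : 0 ≤ C) {𝒢 : Set (α → ℝ)}
    (hg𝒢 : ∀ w, (fun z => g (w, z)) ∈ 𝒢) (h𝒢 : ∀ φ ∈ 𝒢, ∀ z, |φ z| ≤ C) (w : Fin n → ℝ)
    (a l : ℝ) :
    ∫⁻ ω, ENNReal.ofReal (Real.exp (l * deviation (condLaw P Z)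
        (fun v => g (s (history Z n ω), v)) (history Z n ω))) ∂P ≤
      expectedCoveringNumber (condLaw P Z) w a 𝒢 * ENNReal.ofReal
        (Real.exp (2 * |l| * (‖w‖⁻¹ * a) + n * ((2 * l) ^ 2 * C ^ 2 / 2))) := by
  have hD : Measurable fun u : Fin n → α => deviation (condLaw P Z) (fun v => g (s u, v)) u :=
    measurable_deviation _ hg hs measurable_id
  have h := lintegral_history_eq P hZ n 0 (F := fun y => ENNReal.ofReal (Real.exp
    (l * deviation (condLaw P Z) (fun v => g (s y.2, v)) y.2)))
    (ENNReal.measurable_ofReal.comp (((hD.comp measurable_snd).const_mul l).exp))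
  have h0 : ∀ ω, history Z 0 ω = Fin.elim0 := fun ω => Subsingleton.elim _ _
  simp only [zero_add, h0, lintegral_const, measure_univ, mul_one] at h
  refine h.trans_le ?_
  have hE : Measurable fun u : Fin n → α =>
      ENNReal.ofReal (Real.exp (-l * ∑ i, g (s u, u i))) :=
    ENNReal.measurable_ofReal.comp (Measurable.exp (Measurable.const_mul
      (Finset.measurable_fun_sum _ fun i _ => hg.comp (hs.prodMk (measurable_pi_apply i))) _))
  refine le_trans (le_of_eq ?_) ((lintegral_exp_condSum_le (condLaw P Z) l 0 Fin.elim0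
    (g := fun z => g (s z.1, z.2)) (hg.comp ((hs.comp measurable_fst).prodMk measurable_snd))
    (fun z => h𝒢 _ (hg𝒢 _) z.2) hE).trans
      (lintegral_exp_label_le (condLaw P Z) hg hs hC hg𝒢 h𝒢 w a l))
  refine lintegral_congr fun τ => ?_
  rw [← ENNReal.ofReal_mul (Real.exp_pos _).le, ← Real.exp_add, deviation]
  congr 2
  ring

/-- Chernoff bound for the deviations, uniformly over the class. -/
theorem measure_deviation_le [StandardBorelSpace W] (hZ : ∀ t, Measurable (Z t))
    (hg : Measurable g) {C : ℝ} (hC : 0 ≤ C) {𝒢 : Set (α → ℝ)}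
    (hg𝒢 : ∀ w, (fun z => g (w, z)) ∈ 𝒢) (h𝒢 : ∀ φ ∈ 𝒢, ∀ z, |φ z| ≤ C) (w : Fin n → ℝ)
    (a r : ℝ) {l : ℝ} (hl : 0 ≤ l) :
    (P.map (history Z n))
        {u | ∃ y, r < deviation (condLaw P Z) (fun v => g (y, v)) u} ≤
      expectedCoveringNumber (condLaw P Z) w a 𝒢 * ENNReal.ofReal
        (Real.exp (-l * r + 2 * l * (‖w‖⁻¹ * a) + n * ((2 * l) ^ 2 * C ^ 2 / 2))) := by
  have hh := measurable_history hZ n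
  have : IsProbabilityMeasure (P.map (history Z n)) :=
    Measure.isProbabilityMeasure_map hh.aemeasurable
  let D : Set ((Fin n → α) × W) :=
    {z | r < deviation (condLaw P Z) (fun v => g (z.2, v)) z.1}
  have hD : MeasurableSet D :=
    measurableSet_lt measurable_const (measurable_deviation _ hg measurable_snd measurable_fst)
  have himage : {u | ∃ y, r < deviation (condLaw P Z) (fun v => g (y, v)) u} = Prod.fst '' D := by
    ext u
    simp [D]
  rw [himage]
  refine le_of_forall_lt_imp_le_of_dense fun c hc => ?_
  have hne : Nonempty W := by
    by_contra hW
    have : D = ∅ := Set.eq_empty_of_forall_notMem fun z _ => hW ⟨z.2⟩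
    simp [this] at hc
  obtain ⟨A, hA, hcA, s, hs, hsD⟩ := exists_measurable_section _ hD hc
  rw [Measure.map_apply hh hA] at hcA
  refine hcA.trans ?_
  calc P (history Z n ⁻¹' A) = ∫⁻ ω, (history Z n ⁻¹' A).indicator 1 ω ∂P :=
        (lintegral_indicator_one (hh hA)).symm
    _ ≤ ∫⁻ ω, ENNReal.ofReal (Real.exp (-l * r)) * ENNReal.ofReal (Real.exp
        (l * deviation (condLaw P Z) (fun v => g (s (history Z n ω), v)) (history Z n ω))) ∂P := by
        refine lintegral_mono fun ω => Set.indicator_apply_le' (fun hω => ?_) fun _ => zero_le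
        have hlt : r < deviation (condLaw P Z) (fun v => g (s (history Z n ω), v))
          (history Z n ω) := hsD _ hω
        rw [← ENNReal.ofReal_mul (Real.exp_pos _).le, ← Real.exp_add, Pi.one_apply,
          ENNReal.one_le_ofReal, Real.one_le_exp_iff]
        nlinarith
    _ = ENNReal.ofReal (Real.exp (-l * r)) * ∫⁻ ω, ENNReal.ofReal (Real.exp
        (l * deviation (condLaw P Z) (fun v => g (s (history Z n ω), v)) (history Z n ω))) ∂P :=
        lintegral_const_mul' _ _ ENNReal.ofReal_ne_top
    _ ≤ ENNReal.ofReal (Real.exp (-l * r)) * (expectedCoveringNumber (condLaw P Z) w a 𝒢 *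
        ENNReal.ofReal (Real.exp (2 * |l| * (‖w‖⁻¹ * a) + n * ((2 * l) ^ 2 * C ^ 2 / 2)))) := by
        gcongr
        exact lintegral_exp_deviation_le P hZ hg hs hC hg𝒢 h𝒢 w a l
    _ = _ := by
        rw [mul_left_comm, ← ENNReal.ofReal_mul (Real.exp_pos _).le, ← Real.exp_add,
          abs_of_nonneg hl, add_assoc]

/-- The Chernoff bound at the optimal parameter. -/
theorem measure_deviation_gt_le [StandardBorelSpace W] [Nonempty W] (hZ : ∀ t, Measurable (Z t))
    (hn : 0 < n) (hg : Measurable g) {C : ℝ} (hC : 0 ≤ C) {𝒢 : Set (α → ℝ)}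
    (hg𝒢 : ∀ w, (fun z => g (w, z)) ∈ 𝒢) (h𝒢 : ∀ φ ∈ 𝒢, ∀ z, |φ z| ≤ C) {a : ℝ} (ha : 0 < a)
    {δ : ℝ} (hδ : 0 < δ) (hδ1 : δ < 1) :
    (P.map (history Z n)) {u | ∃ y, n * (2 * a + 2 * C * √(2 * (Real.log
        ((expectedCoveringNumber (condLaw P Z) (fun _ : Fin n => (1 / n : ℝ)) a 𝒢).toReal / δ) /
          n))) < deviation (condLaw P Z) (fun v => g (y, v)) u} ≤ ENNReal.ofReal δ := by
  have hn' : (0 : ℝ) < n := Nat.cast_pos.2 hn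
  have : Nonempty (Fin n) := ⟨⟨0, hn⟩⟩
  set w : Fin n → ℝ := fun _ => (1 / n : ℝ) with hw
  have hwn : ‖w‖⁻¹ = n := by
    rw [hw, pi_norm_const, Real.norm_eq_abs, abs_of_pos (by positivity)]
    simp
  set N := expectedCoveringNumber (condLaw P Z) w a 𝒢 with hN
  have hNtop : N ≠ ⊤ := expectedCoveringNumber_ne_top _ (by rw [hwn]; positivity) h𝒢
  have hN1 : 1 ≤ N.toReal := by
    have := one_le_expectedCoveringNumber (condLaw P Z) w a (𝒢 := 𝒢) ⟨_, hg𝒢 (Classical.arbitrary W)⟩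
    simpa using ENNReal.toReal_mono hNtop this
  set L := Real.log (N.toReal / δ) with hL
  have hL0 : 0 ≤ L := Real.log_nonneg (by rw [le_div_iff₀ hδ]; linarith)
  -- For `C = 0` the optimal parameter is undefined, but then all deviations vanish and the
  -- threshold is positive.
  rcases hC.eq_or_lt with rfl | hC'
  · have hzero : ∀ y, (fun v => g (y, v)) = fun _ => 0 := fun y => funext fun v =>
      abs_nonpos_iff.1 (h𝒢 _ (hg𝒢 y) v)
    have hemp : {u : Fin n → α | ∃ y, n * (2 * a + 2 * 0 * √(2 * (L / n))) <
        deviation (condLaw P Z) (fun v => g (y, v)) u} = ∅ := by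
      refine Set.eq_empty_of_forall_notMem fun u ⟨y, hy⟩ => ?_
      rw [hzero y, deviation, condSum_zero] at hy
      simp only [Finset.sum_const_zero, sub_zero, mul_zero, zero_mul, add_zero] at hy
      have : 0 < (n : ℝ) * (2 * a) := by positivity
      linarith
    rw [hemp, measure_empty]
    exact zero_le
  · set b := 2 * C * √(2 * (L / n)) with hb
    have hb2 : n * b ^ 2 = 8 * C ^ 2 * L := by
      rw [hb, mul_pow, Real.sq_sqrt (by positivity)]
      field_simp
      ring
    -- At `r = n * (2 * a + b)` the terms in `a` cancel, and this `l` minimizes the remaining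
    -- exponent `-l * n * b + 2 * n * C ^ 2 * l ^ 2`, with minimum `-L`.
    have hl : 0 ≤ b / (4 * C ^ 2) := by positivity
    refine (measure_deviation_le P hZ hg hC hg𝒢 h𝒢 w a (n * (2 * a + b)) hl).trans_eq ?_
    have hexp : -(b / (4 * C ^ 2)) * (n * (2 * a + b)) + 2 * (b / (4 * C ^ 2)) * (‖w‖⁻¹ * a) +
        n * ((2 * (b / (4 * C ^ 2))) ^ 2 * C ^ 2 / 2) = -L := by
      rw [hwn]
      have : L = n * b ^ 2 / (8 * C ^ 2) := by
        rw [hb2]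
        field_simp
      rw [this]
      field_simp
      ring
    rw [hexp, Real.exp_neg, hL, Real.exp_log (by positivity), ← hN, ← ENNReal.ofReal_toReal hNtop,
      ENNReal.toReal_ofReal (by positivity), ← ENNReal.ofReal_mul (by positivity)]
    congr 1
    field_simp

/-- The bound of `measure_deviation_gt_le`, simultaneously for all the scales of the covers. -/
theorem measure_iUnion_deviation_gt_le [StandardBorelSpace W] [Nonempty W]
    (hZ : ∀ t, Measurable (Z t)) (hn : 0 < n) (hg : Measurable g) {C : ℝ} (hC : 0 ≤ C)
    {𝒢 : Set (α → ℝ)} (hg𝒢 : ∀ w, (fun z => g (w, z)) ∈ 𝒢) (h𝒢 : ∀ φ ∈ 𝒢, ∀ z, |φ z| ≤ C)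
    {δ : ℝ} (hδ : 0 < δ) (hδ1 : δ < 1) :
    (P.map (history Z n)) {u | ∃ a, 0 < a ∧ ∃ y, n * (2 * a + 2 * C * √(2 * (Real.log
        ((expectedCoveringNumber (condLaw P Z) (fun _ : Fin n => (1 / n : ℝ)) a 𝒢).toReal / δ) /
          n))) < deviation (condLaw P Z) (fun v => g (y, v)) u} ≤ ENNReal.ofReal δ := by
  let c : ℝ → ℝ := fun a => n * (2 * a + 2 * C * √(2 * (Real.log
    ((expectedCoveringNumber (condLaw P Z) (fun _ : Fin n => (1 / n : ℝ)) a 𝒢).toReal / δ) / n)))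
  let S : ℝ → Set (Fin n → α) := fun r =>
    {u | ∃ y, r < deviation (condLaw P Z) (fun v => g (y, v)) u}
  have hbdd : BddBelow (c '' Set.Ioi 0) := by
    refine ⟨0, ?_⟩
    rintro _ ⟨a, ha, rfl⟩
    have : (0 : ℝ) < a := ha
    positivity
  -- The events grow as their thresholds fall. A sequence of thresholds decreasing to the infimum
  -- exhausts the union, so continuity from below replaces a union bound.
  obtain ⟨r, hanti, hlim, hr⟩ := exists_seq_tendsto_sInf
    ((Set.nonempty_Ioi (a := (0 : ℝ))).image c) hbdd
  have hmono : Monotone fun k => S (r k) := fun k m hkm u ⟨y, hy⟩ => ⟨y, (hanti hkm).trans_lt hy⟩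
  have hsub : {u | ∃ a, 0 < a ∧ ∃ y, c a < deviation (condLaw P Z) (fun v => g (y, v)) u} ⊆
      ⋃ k, S (r k) := by
    rintro u ⟨a, ha, y, hy⟩
    have hlt := (csInf_le hbdd ⟨a, ha, rfl⟩).trans_lt hy
    obtain ⟨k, hk⟩ := (hlim.eventually (gt_mem_nhds hlt)).exists
    exact Set.mem_iUnion.2 ⟨k, y, hk⟩
  refine (measure_mono hsub).trans ?_
  rw [hmono.measure_iUnion]
  refine iSup_le fun k => ?_
  obtain ⟨a, ha, hak⟩ := hr k
  simp only [← hak]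
  exact measure_deviation_gt_le P hZ hn hg hC hg𝒢 h𝒢 ha hδ hδ1

end Concentration

end

/-! ### Reduction of the theorem to uniform deviations. -/

theorem mainTheorem5 {Ω 𝒳 𝒴 H : Type*} [MeasurableSpace Ω]
    (P : Measure Ω) [IsProbabilityMeasure P]
    [MeasurableSpace 𝒳] [StandardBorelSpace 𝒳] [Nonempty 𝒳]
    [MeasurableSpace 𝒴] [StandardBorelSpace 𝒴] [Nonempty 𝒴]
    [MeasurableSpace H] [StandardBorelSpace H]
    (T : ℕ) (hT : 0 < T)
    (Z : ℕ → Ω → 𝒳 × 𝒴) (hZ : ∀ t, Measurable (Z t))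
    (hX : Measurable[MeasurableSpace.comap (history Z T) inferInstance] fun ω => (Z T ω).1)
    (f : H → 𝒳 × 𝒴 → ℝ) (hf : Measurable fun p : H × (𝒳 × 𝒴) => f p.1 p.2)
    (M : ℝ) (hM : ∀ h z, |f h z| ≤ M)
    (q : H → 𝒳 → 𝒳 × 𝒴 → ℝ)
    (hq : Measurable fun p : H × 𝒳 × (𝒳 × 𝒴) => q p.1 p.2.1 p.2.2)
    (B : ℝ) (hB : ∀ h x z, q h x z ∈ Set.Icc (-B) B)
    (δ : ℝ) (hδ : 0 < δ) :
    P {ω | ¬ ∀ h : H, ∀ α : ℝ, 0 < α →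
      targetRisk P Z T (f h) ω ≤
        (1 / T : ℝ) * ∑ t ∈ Finset.range T, q h (Z T ω).1 (Z t ω) * f h (Z t ω)
          + weightedDisc P Z T f q ω + 2 * α
          + 2 * M * B * √(2 * (Real.log
              ((expectedCoveringNumber (condLaw P Z) (fun _ : Fin T => (1 / T : ℝ)) α
                (productClass f q)).toReal / δ) / T))}
      ≤ ENNReal.ofReal δ := by
  rcases isEmpty_or_nonempty H with hH | hH
  · simp
  rcases le_or_gt 1 δ with hδ1 | hδ1
  · exact prob_le_one.trans (by rwa [ENNReal.one_le_ofReal])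
  have hT' : (0 : ℝ) < T := Nat.cast_pos.2 hT
  obtain ⟨h₀⟩ := id hH
  obtain ⟨z₀⟩ := (inferInstance : Nonempty (𝒳 × 𝒴))
  have hM0 : 0 ≤ M := (abs_nonneg _).trans (hM h₀ z₀)
  have hqB : ∀ h x z, |q h x z| ≤ B := fun h x z => abs_le.2 (hB h x z)
  have hB0 : 0 ≤ B := (abs_nonneg _).trans (hqB h₀ z₀.1 z₀)
  let g : (H × 𝒳) × (𝒳 × 𝒴) → ℝ := fun y => q y.1.1 y.1.2 y.2 * f y.1.1 y.2
  have hg : Measurable g :=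
    (hq.comp ((measurable_fst.comp measurable_fst).prodMk
      ((measurable_snd.comp measurable_fst).prodMk measurable_snd))).mul
      (hf.comp ((measurable_fst.comp measurable_fst).prodMk measurable_snd))
  have hqf : ∀ h x z, |q h x z * f h z| ≤ M * B := fun h x z => by
    rw [abs_mul, mul_comm M]
    exact mul_le_mul (hqB h x z) (hM h z) (abs_nonneg _) hB0
  have hg𝒢 : ∀ w, (fun z => g (w, z)) ∈ productClass f q := fun w => ⟨w.1, w.2, rfl⟩
  have h𝒢 : ∀ φ ∈ productClass f q, ∀ z, |φ z| ≤ M * B := by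
    rintro _ ⟨h, x, rfl⟩ z
    exact hqf h x z
  have hint : ∀ (ν : Measure (𝒳 × 𝒴)) [IsProbabilityMeasure ν] (φ : 𝒳 × 𝒴 → ℝ) (K : ℝ),
      (∀ z, |φ z| ≤ K) → |∫ z, φ z ∂ν| ≤ K := fun ν _ φ K hφ => by
    simpa using norm_integral_le_of_norm_le_const (μ := ν) (f := φ) (.of_forall hφ)
  -- Boundedness must be checked, since the supremum of an unbounded real family is `0` by default.
  have hdisc : ∀ ω h, targetRisk P Z T (f h) ω - (1 / T : ℝ) * ∑ t ∈ Finset.range T,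
      frozenRisk P Z T t (fun x z => q h x z * f h z) ω ≤ weightedDisc P Z T f q ω := by
    intro ω h
    refine le_ciSup (f := fun h => targetRisk P Z T (f h) ω - (1 / T : ℝ) *
      ∑ t ∈ Finset.range T, frozenRisk P Z T t (fun x z => q h x z * f h z) ω)
      ⟨M + (1 / T : ℝ) * ∑ t ∈ Finset.range T, M * B, ?_⟩ h
    rintro _ ⟨h', rfl⟩
    have h1 : targetRisk P Z T (f h') ω ≤ M := (le_abs_self _).trans (hint _ _ _ (hM h'))
    have h2 : ∀ t, -frozenRisk P Z T t (fun x z => q h' x z * f h' z) ω ≤ M * B := fun t =>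
      (neg_le_abs _).trans (hint _ _ _ (hqf h' (Z T ω).1))
    simp only
    rw [sub_eq_add_neg, ← mul_neg, ← Finset.sum_neg_distrib]
    gcongr
    exact h2 _
  -- The failure set need not be measurable; its outer probability is at most the outer measure,
  -- under the law of the path, of the set of paths with a large deviation.
  refine le_trans (measure_mono fun ω hω => ?_)
    ((Measure.le_map_apply (measurable_history hZ T).aemeasurable _).trans
      (measure_iUnion_deviation_gt_le P hZ hT hg (mul_nonneg hM0 hB0) hg𝒢 h𝒢 hδ hδ1))
  simp only [Set.mem_ofPred_eq, not_forall, not_le] at hω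
  obtain ⟨h, a, ha, hlt⟩ := hω
  -- The realized query point is used as one value of the parameter `x`, over which the deviation
  -- bound is uniform.
  refine ⟨a, ha, (h, (Z T ω).1), ?_⟩
  have hcond := condSum_eq_sum (condLaw P Z) (fun z => g ((h, (Z T ω).1), z)) (fun i => Z i ω) T 0
  have h0 : (fun i : Fin 0 => Z i ω) = Fin.elim0 := Subsingleton.elim _ _
  simp only [zero_add, h0] at hcond
  have hrisk : ∀ t k : ℕ, k = t →
      ∫ z, g ((h, (Z T ω).1), z) ∂(condLaw P Z k fun j : Fin k => Z j ω) =
        frozenRisk P Z T t (fun x z => q h x z * f h z) ω := by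
    rintro t _ rfl
    rfl
  have hdev : deviation (condLaw P Z) (fun z => g ((h, (Z T ω).1), z)) (history Z T ω) =
      ∑ t ∈ Finset.range T, frozenRisk P Z T t (fun x z => q h x z * f h z) ω -
        ∑ t ∈ Finset.range T, q h (Z T ω).1 (Z t ω) * f h (Z t ω) := by
    rw [deviation, Finset.sum_range fun t => q h (Z T ω).1 (Z t ω) * f h (Z t ω)]
    exact congrArg₂ (· - ·) (hcond.trans (Finset.sum_congr rfl fun t _ => hrisk t _ (zero_add t)))
      rfl
  rw [hdev]
  have hd := hdisc ω h
  rw [← lt_div_iff₀' hT', sub_div]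
  simp only [one_div, inv_mul_eq_div] at hd hlt ⊢
  have hassoc : 2 * (M * B) = 2 * M * B := by ring
  rw [hassoc]
  linarith
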